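/- Let $G$ be a (finite-dimensional, smooth, real) Lie group with unit $e$, equipped with a smooth bi-invariant Riemannian metric $\langle\cdot,\cdot\rangle$, i.e. the differentials of all left shifts $l_g(h)=gh$ and of all right shifts $r_g(h)=hg$ preserve the scalar products of tangent vectors. Let $d$ be the Riemannian distance (the infimum of the lengths of paths, $+\infty$ for points in different components). A geodesic of speed $c\ge 0$ on an interval $J\subseteq\mathbb R$ is a locally shortest curve parametrized proportionally to arc length with factor $c$: a curve $\gamma:J\to G$ such that each $t\in J$ has a neighbourhood $U$ in $J$ with $d(\gamma(s),\gamma(s'))=c|s-s'|$ for all $s,s'\in U$. 1. Let $J\subseteq\mathbb R$ be an interval with more than one point, $0\in J$, and let $\gamma:J\to G$ be a geodesic of speed $c$ with $\gamma(0)=e$. Then $\gamma$ is (the restriction to $J$ of) a $1$-parameter subgroup $\varphi$ of $G$, i.e. of a smooth homomorphism $\varphi:(\mathbb R,+)\to G$; in particular $\gamma=\varphi$ if $J=\mathbb R$. Moreover, there is $\psi_0\in T_eG$ with $|\psi_0|=c$ such that $\varphi$ is an integral curve of the right-invariant vector field $g\mapsto (dr_g)_e(\psi_0)$, so that $\psi_0=\dot\varphi(0)$.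 2. For every $\psi_0\in T_eG$, the geodesic vector field $v(g)=(dl_g)_e(u(g))$, where $u(g)\in T_eG$ is determined by $\langle u(g),w\rangle=\langle\psi_0,\operatorname{Ad}(g)w\rangle$ for all $w\in T_eG$, exists, is unique, and equals the right-invariant vector field $v(g)=(dr_g)_e(\psi_0)$. -/

import Mathlib

open Bundle
open scoped Manifold ContDiff Topology

noncomputable section

section

variable {E : Type*} [NormedAddCommGroup E] [NormedSpace ℝ E]
  {G : Type*} [TopologicalSpace G] [ChartedSpace E G] [Group G]

/-- A `1`-parameter subgroup of a Lie group `G`: a homomorphism of Lie groups `(ℝ, +) → G`,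
that is, a smooth map which is a homomorphism of groups. -/
def IsOneParameterSubgroup (E : Type*) [NormedAddCommGroup E] [NormedSpace ℝ E]
    {G : Type*} [TopologicalSpace G] [ChartedSpace E G] [Group G] (φ : ℝ → G) : Prop :=
  ContMDiff 𝓘(ℝ, ℝ) 𝓘(ℝ, E) ∞ φ ∧ ∀ s t : ℝ, φ (s + t) = φ s * φ t

/-- The right-invariant vector field `g ↦ (d r_g)_e (ψ)`, where `r_g h = h * g`. -/
def rightInvariantField (ψ : TangentSpace 𝓘(ℝ, E) (1 : G)) (g : G) : TangentSpace 𝓘(ℝ, E) g :=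
  mfderiv 𝓘(ℝ, E) 𝓘(ℝ, E) (fun h : G ↦ h * g) 1 ψ

/-- The adjoint representation `Ad g = (d I(g))_e`, where `I(g) h = g * h * g⁻¹`. -/
def adjointRep (g : G) (w : TangentSpace 𝓘(ℝ, E) (1 : G)) : TangentSpace 𝓘(ℝ, E) (1 : G) :=
  mfderiv 𝓘(ℝ, E) 𝓘(ℝ, E) (fun h : G ↦ g * h * g⁻¹) 1 w

/-- A Riemannian metric on `G` is bi-invariant if the differentials of all left shifts and of all
right shifts preserve its scalar products. -/
def IsBiinvariantMetric (E : Type*) [NormedAddCommGroup E] [NormedSpace ℝ E]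
    (G : Type*) [TopologicalSpace G] [ChartedSpace E G] [Group G]
    [RiemannianBundle (fun x : G ↦ TangentSpace 𝓘(ℝ, E) x)] : Prop :=
  (∀ (g h : G) (v w : TangentSpace 𝓘(ℝ, E) h),
    inner ℝ (mfderiv 𝓘(ℝ, E) 𝓘(ℝ, E) (fun x : G ↦ g * x) h v)
      (mfderiv 𝓘(ℝ, E) 𝓘(ℝ, E) (fun x : G ↦ g * x) h w) = inner ℝ v w) ∧
  (∀ (g h : G) (v w : TangentSpace 𝓘(ℝ, E) h),
    inner ℝ (mfderiv 𝓘(ℝ, E) 𝓘(ℝ, E) (fun x : G ↦ x * g) h v)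
      (mfderiv 𝓘(ℝ, E) 𝓘(ℝ, E) (fun x : G ↦ x * g) h w) = inner ℝ v w)

/-- `γ`, restricted to the interval `J`, is a geodesic of constant speed `c`: a locally shortest
curve parametrized proportionally to arc length with factor `c`. Every parameter in `J` has a
neighbourhood in `J` on which the Riemannian distance (the infimum of the lengths of paths) between
two points of the curve is `c` times the distance of their parameters. -/
def IsGeodesicOn (E : Type*) [NormedAddCommGroup E] [NormedSpace ℝ E]
    {M : Type*} [TopologicalSpace M] [ChartedSpace E M]
    [RiemannianBundle (fun x : M ↦ TangentSpace 𝓘(ℝ, E) x)]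
    (γ : ℝ → M) (J : Set ℝ) (c : ℝ) : Prop :=
  0 ≤ c ∧ ∀ t ∈ J, ∃ U ∈ 𝓝[J] t, ∀ s ∈ U ∩ J, ∀ s' ∈ U ∩ J,
    Manifold.riemannianEDist 𝓘(ℝ, E) (γ s) (γ s') = ENNReal.ofReal (c * |s - s'|)

/-- `V` is the geodesic vector field of a left-invariant Riemannian metric on `G` determined by
`ψ ∈ T_e G`, that is, `V g = (d l_g)_e (u g)` where the vector `u g ∈ T_e G` is characterized by
`⟪u g, w⟫ = ⟪ψ, Ad g w⟫` for all `w ∈ T_e G`. -/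
def IsGeodesicVectorField [RiemannianBundle (fun x : G ↦ TangentSpace 𝓘(ℝ, E) x)]
    (ψ : TangentSpace 𝓘(ℝ, E) (1 : G)) (V : (g : G) → TangentSpace 𝓘(ℝ, E) g) : Prop :=
  ∃ u : G → TangentSpace 𝓘(ℝ, E) (1 : G),
    (∀ (g : G) (w : TangentSpace 𝓘(ℝ, E) (1 : G)), inner ℝ (u g) w = inner ℝ ψ (adjointRep g w)) ∧
    ∀ g : G, V g = mulInvariantVectorField (u g) g

end

end

/-! The distance `d` is bi-invariant. Take `t < t'` on a shortest piece of `γ`, a small `h`, and the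
increments `A = γ(t+h) γ(t)⁻¹`, `B = γ(t'+h) γ(t')⁻¹`, both at distance `c h` from `e`. For every
`a`, the broken path `γ(t), a γ(t+h), a γ(t'), γ(t'+h)` cannot beat `γ`. Its middle leg is a left
translate of a piece of `γ`, so `d(e, aA) + d(a, B) ≥ 2ch`. Near `e`, the metric is Euclidean and
the product is addition to first order. Choosing `a ≈ (B - A)/2` gives `|A + B| ≥ 2ch - o(h)`, and
the parallelogram law yields `d(A, B) = o(h)` (`edist_le_of_no_shortcut`).

Cutting a length `T` into `n` steps, bi-invariance lets the errors `o(T/n)` add up, so increments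
over equal times coincide (`increments_eq`). Hence `γ` is locally a translate of a homomorphism, and
these homomorphisms agree on overlaps (`exists_hom_of_locally`). In coordinates a homomorphism of
constant speed is Lipschitz, hence differentiable somewhere, hence everywhere by translation. It
then solves a smooth differential equation and is smooth (`contMDiff_of_hom`).

For the vector field, `r_g ∘ I(g) = l_g` and bi-invariance turn the defining equation of `u(g)` into
equality of `(dl_g) u(g)` and `(dr_g) ψ₀` when tested against all `(dl_g) w`. -/

/-! ### Homomorphisms from `ℝ` to a group, built from local data. -/

/-- A map which is additive on `[0, 2]` extends from `[0, 1]` to a homomorphism on `ℝ`. -/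
theorem exists_hom_extending_of_add_on_Icc {G : Type*} [Group G] (p : ℝ → G)
    (hp : ∀ u v : ℝ, 0 ≤ u → 0 ≤ v → u + v ≤ 2 → p (u + v) = p u * p v) :
    ∃ φ : ℝ → G, (∀ s t, φ (s + t) = φ s * φ t) ∧ ∀ u ∈ Set.Icc (0 : ℝ) 1, φ u = p u := by
  have h0 : p 0 = 1 := by simpa using hp 0 0 le_rfl le_rfl (by norm_num)
  have hc : ∀ u v : ℝ, 0 ≤ u → 0 ≤ v → u + v ≤ 2 → Commute (p u) (p v) := by
    intro u v hu hv h
    rw [Commute, SemiconjBy, ← hp u v hu hv h, ← hp v u hv hu (by linarith), add_comm]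
  -- This is the only possible extension. Values of `p` commute with `p 1`, and a carry in the
  -- fractional parts costs one factor `p 1`.
  refine ⟨fun t ↦ p 1 ^ ⌊t⌋ * p (Int.fract t), fun s t ↦ ?_, fun u hu ↦ ?_⟩
  · have hs0 := Int.fract_nonneg s
    have ht0 := Int.fract_nonneg t
    have hs1 := Int.fract_lt_one s
    have ht1 := Int.fract_lt_one t
    have key : p 1 ^ ⌊s⌋ * p (Int.fract s) * (p 1 ^ ⌊t⌋ * p (Int.fract t)) =
        p 1 ^ (⌊s⌋ + ⌊t⌋) * p (Int.fract s + Int.fract t) := by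
      rw [hp _ _ hs0 ht0 (by linarith), zpow_add, mul_assoc, mul_assoc, ← mul_assoc (p _) (p 1 ^ _),
        ((hc _ 1 hs0 zero_le_one (by linarith)).zpow_right ⌊t⌋).eq, mul_assoc]
    simp only [key]
    rcases lt_or_ge (Int.fract s + Int.fract t) 1 with h | h
    · have hf : ⌊s + t⌋ = ⌊s⌋ + ⌊t⌋ := by
        rw [Int.floor_eq_iff]
        have := Int.self_sub_floor s
        have := Int.self_sub_floor t
        push_cast
        constructor <;> linarith
      rw [Int.fract, hf]
      congr 2
      push_cast
      rw [Int.fract, Int.fract]; ring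
    · have hf : ⌊s + t⌋ = ⌊s⌋ + ⌊t⌋ + 1 := by
        rw [Int.floor_eq_iff]
        have := Int.self_sub_floor s
        have := Int.self_sub_floor t
        push_cast
        constructor <;> linarith
      have h2 : Int.fract s + Int.fract t = 1 + Int.fract (s + t) := by
        rw [Int.fract, Int.fract, Int.fract, hf]
        push_cast
        ring
      rw [h2, hp _ _ zero_le_one (Int.fract_nonneg _) (by linarith), hf, zpow_add_one, mul_assoc]
  · rcases hu.2.lt_or_eq with h | rfl
    · simp [Int.floor_eq_zero_iff.2 ⟨hu.1, h⟩, Int.fract_eq_self.2 ⟨hu.1, h⟩]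
    · simp [h0]

theorem hom_zero {G : Type*} [Group G] {φ : ℝ → G} (h : ∀ s t, φ (s + t) = φ s * φ t) :
    φ 0 = 1 := by simpa using h 0 0

theorem hom_neg {G : Type*} [Group G] {φ : ℝ → G} (h : ∀ s t, φ (s + t) = φ s * φ t) (t : ℝ) :
    φ (-t) = (φ t)⁻¹ := by
  rw [eq_inv_iff_mul_eq_one, ← h, neg_add_cancel, hom_zero h]

theorem hom_nat_mul {G : Type*} [Group G] {φ : ℝ → G} (h : ∀ s t, φ (s + t) = φ s * φ t)
    (n : ℕ) (t : ℝ) : φ (n * t) = φ t ^ n := by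
  induction n with
  | zero => simpa using hom_zero h
  | succ n ih => rw [Nat.cast_succ, add_mul, one_mul, h, ih, pow_succ]

/-- Every `t ≥ 0` is `n` times an element of `[0, δ]`; negative `t` follow by inversion. -/
theorem hom_eq_of_eqOn_Icc {G : Type*} [Group G] {φ χ : ℝ → G}
    (hφ : ∀ s t, φ (s + t) = φ s * φ t) (hχ : ∀ s t, χ (s + t) = χ s * χ t) {δ : ℝ} (hδ : 0 < δ)
    (h : ∀ t ∈ Set.Icc 0 δ, φ t = χ t) : φ = χ := by
  have hpos : ∀ t, 0 ≤ t → φ t = χ t := by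
    intro t ht
    obtain ⟨n, hn⟩ := exists_nat_gt (t / δ)
    have hn0 : (0 : ℝ) < n := (div_nonneg ht hδ.le).trans_lt hn
    have e : t = n * (t / n) := by field_simp
    rw [e, hom_nat_mul hφ, hom_nat_mul hχ, h]
    refine ⟨by positivity, ?_⟩
    rw [div_lt_iff₀ hδ] at hn
    rw [div_le_iff₀ hn0]
    linarith
  ext t
  rcases le_total 0 t with ht | ht
  · exact hpos t ht
  · rw [← neg_neg t, hom_neg hφ, hom_neg hχ, hpos _ (neg_nonneg.2 ht)]

/-- A curve on an interval whose increments are translation invariant is a translate of a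
homomorphism. -/
theorem exists_hom_of_increments {G : Type*} [Group G] {I : Set ℝ} (hI : I.OrdConnected)
    {f : ℝ → G}
    (hf : ∀ s s' T, 0 ≤ T → s ∈ I → s + T ∈ I → s' ∈ I → s' + T ∈ I →
      f (s + T) * (f s)⁻¹ = f (s' + T) * (f s')⁻¹) :
    ∃ φ : ℝ → G, (∀ s t, φ (s + t) = φ s * φ t) ∧ ∀ s ∈ I, ∀ t ∈ I, f s = φ (s - t) * f t := by
  by_cases hsub : I.Subsingleton
  · exact ⟨fun _ ↦ 1, by simp, fun s hs t ht ↦ by simp [hsub hs ht]⟩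
  obtain ⟨a, ha, b, hb, hab⟩ : ∃ a ∈ I, ∃ b ∈ I, a < b := by
    rw [Set.not_subsingleton_iff] at hsub
    exact hsub.exists_lt
  -- Half the length, so that parameters in `[0, 2]` fill exactly `[a, b]`.
  set L : ℝ := (b - a) / 2 with hL
  have hL0 : 0 < L := by rw [hL]; linarith
  have hmem : ∀ u, 0 ≤ u → u ≤ 2 → a + u * L ∈ I := fun u h0 h2 ↦
    hI.out ha hb ⟨by nlinarith, by nlinarith⟩
  obtain ⟨χ, hχ, hχp⟩ := exists_hom_extending_of_add_on_Icc
    (fun u ↦ f (a + u * L) * (f a)⁻¹) (by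
      intro u v hu hv huv
      have h1 := hf (a + v * L) a (u * L) (by positivity) (hmem v hv (by linarith))
        (by convert hmem (u + v) (by positivity) huv using 1; ring) ha (hmem u hu (by linarith))
      rw [← h1, show a + (u + v) * L = a + v * L + u * L by ring]
      group)
  refine ⟨fun t ↦ χ (t / L), fun s t ↦ by simp only [add_div, hχ], ?_⟩
  have step : ∀ t h, 0 ≤ h → h ≤ L → t ∈ I → t + h ∈ I → f (t + h) = χ (h / L) * f t := by
    intro t h h0 hh ht hth
    have h1 := hχp (h / L) ⟨by positivity, by rw [div_le_one hL0]; exact hh⟩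
    have h2 : h / L * L = h := by field_simp
    simp only [h2] at h1
    rw [h1, hf a t h h0 ha (by rw [← h2]; exact hmem _ (by positivity) (by
      rw [div_le_iff₀ hL0]; linarith)) ht hth]
    group
  have main : ∀ t ∈ I, ∀ s ∈ I, t ≤ s → f s = χ ((s - t) / L) * f t := by
    intro t ht s hs hts
    obtain ⟨n, hn⟩ := exists_nat_gt ((s - t) / L)
    have hn0 : (0 : ℝ) < n := (div_nonneg (sub_nonneg.2 hts) hL0.le).trans_lt hn
    set h := (s - t) / n with hh
    have hnh : n * h = s - t := by rw [hh]; field_simp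
    have h0 : 0 ≤ h := div_nonneg (sub_nonneg.2 hts) hn0.le
    have hhL : h ≤ L := by
      rw [div_lt_iff₀ hL0] at hn
      rw [hh, div_le_iff₀ hn0]; linarith
    -- Steps of length at most `L` are controlled by `step`; a longer interval is cut into `n` of
    -- them.
    have ind : ∀ k : ℕ, k ≤ n → f (t + k * h) = χ (k * h / L) * f t := by
      intro k
      induction k with
      | zero => intro _; simp [hom_zero hχ]
      | succ k ih =>
        intro hk
        have hk' : ((k : ℝ) + 1) ≤ n := by exact_mod_cast hk
        have hm : ∀ x : ℝ, 0 ≤ x → x ≤ n → t + x * h ∈ I := fun x h1 h2 ↦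
          hI.out ht hs ⟨by nlinarith, by nlinarith⟩
        have h3 := step (t + k * h) h h0 hhL (hm k (by positivity) (by linarith)) (by
          convert hm (k + 1) (by positivity) hk' using 1; ring)
        rw [Nat.cast_succ, show t + (k + 1 : ℝ) * h = t + k * h + h by ring, h3, ih (by omega),
          ← mul_assoc, ← hχ, show h / L + k * h / L = (k + 1) * h / L by ring]
    have := ind n le_rfl
    rwa [hnh, add_sub_cancel] at this
  intro s hs t ht
  rcases le_total t s with h | h
  · exact main t ht s hs h
  · rw [main s hs t ht h, ← mul_assoc, ← hχ, ← add_div]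
    simp [hom_zero hχ]

/-- A curve on an interval which is locally a translate of homomorphisms is globally a translate
of one homomorphism. -/
theorem exists_hom_of_locally {G : Type*} [Group G] {J : Set ℝ} (hJ : J.OrdConnected)
    (hJn : J.Nontrivial) (h0 : (0 : ℝ) ∈ J) {f : ℝ → G} (hf0 : f 0 = 1)
    (hf : ∀ t ∈ J, ∃ U ∈ 𝓝 t, ∃ φ : ℝ → G, (∀ s t, φ (s + t) = φ s * φ t) ∧
      ∀ s ∈ U ∩ J, ∀ s' ∈ U ∩ J, f s = φ (s - s') * f s') :
    ∃ φ : ℝ → G, (∀ s t, φ (s + t) = φ s * φ t) ∧ Set.EqOn f φ J := by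
  choose! U hU φ hφ hfφ using hf
  have hpre : IsPreconnected J := hJ.isPreconnected
  -- Both homomorphisms describe `f` near `s`. As `s` may be an endpoint of `J`, they are compared
  -- on the side where `J` has another point `b`.
  have hloc : ∀ t ∈ J, ∀ᶠ s in 𝓝[J] t, φ s = φ t := by
    intro t ht
    obtain ⟨ε, hε, hball⟩ := Metric.mem_nhds_iff.1 (hU t ht)
    filter_upwards [self_mem_nhdsWithin, mem_nhdsWithin_of_mem_nhds (Metric.ball_mem_nhds t hε)]
      with s hs hst
    have hW : U s ∩ Metric.ball t ε ∈ 𝓝 s :=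
      Filter.inter_mem (hU s hs) (Metric.isOpen_ball.mem_nhds hst)
    obtain ⟨δ, hδ, hW⟩ := Metric.mem_nhds_iff.1 hW
    obtain ⟨b, hb, hbs⟩ := hJn.exists_ne s
    rcases hbs.lt_or_gt with h | h
    · refine hom_eq_of_eqOn_Icc (hφ s hs) (hφ t ht) (δ := min (δ / 2) (s - b))
        (by simp [hδ, h]) fun x hx ↦ ?_
      have hx2 := hx.2.trans (min_le_left _ _)
      have hx3 := hx.2.trans (min_le_right _ _)
      have m1 : s - x ∈ J := hJ.out hb hs ⟨by linarith, by linarith [hx.1]⟩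
      have m2 : s - x ∈ Metric.ball s δ := by
        rw [Metric.mem_ball, Real.dist_eq, abs_lt]; constructor <;> linarith [hx.1]
      have m3 : s ∈ Metric.ball s δ := Metric.mem_ball_self hδ
      have e1 := hfφ s hs s ⟨(hW m3).1, hs⟩ (s - x) ⟨(hW m2).1, m1⟩
      have e2 := hfφ t ht s ⟨hball (hW m3).2, hs⟩ (s - x) ⟨hball (hW m2).2, m1⟩
      rw [sub_sub_cancel] at e1 e2
      exact mul_right_cancel (e1.symm.trans e2)
    · refine hom_eq_of_eqOn_Icc (hφ s hs) (hφ t ht) (δ := min (δ / 2) (b - s))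
        (by simp [hδ, h]) fun x hx ↦ ?_
      have hx2 := hx.2.trans (min_le_left _ _)
      have hx3 := hx.2.trans (min_le_right _ _)
      have m1 : s + x ∈ J := hJ.out hs hb ⟨by linarith [hx.1], by linarith⟩
      have m2 : s + x ∈ Metric.ball s δ := by
        rw [Metric.mem_ball, Real.dist_eq, abs_lt]; constructor <;> linarith [hx.1]
      have m3 : s ∈ Metric.ball s δ := Metric.mem_ball_self hδ
      have e1 := hfφ s hs (s + x) ⟨(hW m2).1, m1⟩ s ⟨(hW m3).1, hs⟩
      have e2 := hfφ t ht (s + x) ⟨hball (hW m2).2, m1⟩ s ⟨hball (hW m3).2, hs⟩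
      rw [add_sub_cancel_left] at e1 e2
      exact mul_right_cancel (e1.symm.trans e2)
  have hconst : ∀ {Y : Type _} (F : ℝ → Y), (∀ t ∈ J, ∀ᶠ s in 𝓝[J] t, F s = F t) →
      ∀ t ∈ J, F t = F 0 := by
    intro Y F hF t ht
    -- For the discrete topology, locally constant means continuous, and `J` is connected.
    let _ : TopologicalSpace Y := ⊥
    have : DiscreteTopology Y := ⟨rfl⟩
    refine hpre.constant (f := F) (fun t ht ↦ ?_) ht h0
    exact tendsto_nhds_of_eventually_eq (hF t ht)
  have hφ0 := hconst φ hloc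
  refine ⟨φ 0, hφ 0 h0, fun t ht ↦ ?_⟩
  have hF : ∀ t ∈ J, φ 0 (-t) * f t = φ 0 (-0) * f 0 := by
    refine hconst (fun t ↦ φ 0 (-t) * f t) (fun t ht ↦ ?_)
    filter_upwards [self_mem_nhdsWithin, mem_nhdsWithin_of_mem_nhds (hU t ht)] with s hs hsU
    rw [hfφ t ht s ⟨hsU, hs⟩ t ⟨mem_of_mem_nhds (hU t ht), ht⟩, hφ0 t ht, ← mul_assoc,
      ← hφ 0 h0]
    congr 2; ring
  have := hF t ht
  rw [hom_neg (hφ 0 h0), neg_zero, hom_zero (hφ 0 h0), hf0, mul_one,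
    inv_mul_eq_one] at this
  exact this.symm

/-! ### The Riemannian distance compared with the distance in a chart. -/

section

open Manifold MeasureTheory

variable {E : Type*} [NormedAddCommGroup E] [NormedSpace ℝ E]
  {M : Type*} [TopologicalSpace M] [ChartedSpace E M]
  [RiemannianBundle (fun x : M ↦ TangentSpace 𝓘(ℝ, E) x)]
  [IsManifold 𝓘(ℝ, E) 1 M]
  [IsContinuousRiemannianBundle E (fun x : M ↦ TangentSpace 𝓘(ℝ, E) x)]

/-- The chart at `x`, read in the tangent space at `x`, is infinitesimally almost isometric. -/
theorem exists_almost_isometric_chart (x : M) :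
    ∃ K : TangentSpace 𝓘(ℝ, E) x ≃L[ℝ] E, ∀ r : ℝ, 1 < r → ∀ᶠ y in 𝓝 x,
      ∀ v : TangentSpace 𝓘(ℝ, E) y,
        ‖K.symm (mfderiv 𝓘(ℝ, E) 𝓘(ℝ, E) (extChartAt 𝓘(ℝ, E) x) y v)‖ ≤ r * ‖v‖ ∧
        ‖v‖ ≤ r * ‖K.symm (mfderiv 𝓘(ℝ, E) 𝓘(ℝ, E) (extChartAt 𝓘(ℝ, E) x) y v)‖ := by
  set e := trivializationAt E (fun x : M ↦ TangentSpace 𝓘(ℝ, E) x) x with he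
  have hx : x ∈ e.baseSet := by simp [he]
  -- The derivative of the chart at `y` is the trivialization of the tangent bundle at `y`. The same
  -- `K` thus serves for all `r`, since fibre norms vary continuously.
  refine ⟨e.continuousLinearEquivAt ℝ x hx, fun r hr ↦ ?_⟩
  filter_upwards [eventually_norm_symmL_trivializationAt_self_comp_lt E
    (fun x : M ↦ TangentSpace 𝓘(ℝ, E) x) x hr,
    eventually_norm_symmL_trivializationAt_comp_self_lt E
    (fun x : M ↦ TangentSpace 𝓘(ℝ, E) x) x hr, chart_source_mem_nhds E x] with y h1 h2 hy v
  have hy' : y ∈ e.baseSet := by simpa [he] using hy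
  have hD : (e.continuousLinearEquivAt ℝ x hx).symm
      (mfderiv 𝓘(ℝ, E) 𝓘(ℝ, E) (extChartAt 𝓘(ℝ, E) x) y v) =
      e.symmL ℝ x (e.continuousLinearMapAt ℝ y v) :=
    (congrArg (fun L : TangentSpace 𝓘(ℝ, E) y →L[ℝ] E ↦
      (e.continuousLinearEquivAt ℝ x hx).symm (L v))
      (TangentBundle.continuousLinearMapAt_trivializationAt hy).symm).trans
    (congrFun (e.symm_continuousLinearEquivAt_eq hx) _)
  rw [hD]
  constructor
  · have h3 := ContinuousLinearMap.le_opNorm (e.symmL ℝ x ∘L e.continuousLinearMapAt ℝ y) v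
    exact h3.trans (mul_le_mul_of_nonneg_right h1.le (norm_nonneg _))
  · have h3 := ContinuousLinearMap.le_opNorm (e.symmL ℝ y ∘L e.continuousLinearMapAt ℝ x)
      ((e.symmL ℝ x) (e.continuousLinearMapAt ℝ y v))
    have h4 : (e.symmL ℝ y ∘L e.continuousLinearMapAt ℝ x)
      ((e.symmL ℝ x) (e.continuousLinearMapAt ℝ y v)) = v := by
      simp only [ContinuousLinearMap.comp_apply]
      rw [e.continuousLinearMapAt_symmL hx, e.symmL_continuousLinearMapAt hy']
    rw [h4] at h3
    exact h3.trans (mul_le_mul_of_nonneg_right h2.le (norm_nonneg _))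

omit [IsContinuousRiemannianBundle E (fun x : M ↦ TangentSpace 𝓘(ℝ, E) x)] in
theorem enorm_chart_sub_le_pathELength {x : M} (K : TangentSpace 𝓘(ℝ, E) x ≃L[ℝ] E) {r : ℝ}
    (hr : 0 ≤ r) {γ : ℝ → M} (hγ : ContMDiff 𝓘(ℝ, ℝ) 𝓘(ℝ, E) 1 γ)
    (hs : ∀ t ∈ Set.Icc (0 : ℝ) 1, γ t ∈ (chartAt E x).source)
    (hK : ∀ t ∈ Set.Icc (0 : ℝ) 1, ∀ v : TangentSpace 𝓘(ℝ, E) (γ t),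
      ‖K.symm (mfderiv 𝓘(ℝ, E) 𝓘(ℝ, E) (extChartAt 𝓘(ℝ, E) x) (γ t) v)‖ ≤ r * ‖v‖) :
    ‖K.symm (extChartAt 𝓘(ℝ, E) x (γ 1) - extChartAt 𝓘(ℝ, E) x (γ 0))‖ₑ ≤
      ENNReal.ofReal r * pathELength 𝓘(ℝ, E) γ 0 1 := by
  set β : ℝ → E := extChartAt 𝓘(ℝ, E) x ∘ γ with hβ
  have hβs : ContDiffOn ℝ 1 β (Set.Icc 0 1) := by
    rw [← contMDiffOn_iff_contDiffOn]
    exact contMDiffOn_extChartAt.comp (I' := 𝓘(ℝ, E)) (t := (chartAt E x).source)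
      hγ.contMDiffOn hs
  have hη : ContDiffOn ℝ 1 (fun t ↦ K.symm (β t)) (Set.Icc 0 1) :=
    K.symm.contDiff.comp_contDiffOn hβs
  have h1 := enorm_sub_le_lintegral_derivWithin_Icc_of_contDiffOn_Icc hη zero_le_one
  rw [← map_sub] at h1
  refine h1.trans ?_
  rw [pathELength_eq_lintegral_mfderivWithin_Icc,
    ← lintegral_const_mul' _ _ ENNReal.ofReal_ne_top]
  refine setLIntegral_mono' measurableSet_Icc fun t ht ↦ ?_
  have hu : UniqueDiffWithinAt ℝ (Set.Icc (0 : ℝ) 1) t := uniqueDiffOn_Icc zero_lt_one t ht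
  have h2 : mfderivWithin 𝓘(ℝ, ℝ) 𝓘(ℝ, E) β (Set.Icc 0 1) t =
      (mfderiv 𝓘(ℝ, E) 𝓘(ℝ, E) (extChartAt 𝓘(ℝ, E) x) (γ t)) ∘L
        (mfderivWithin 𝓘(ℝ, ℝ) 𝓘(ℝ, E) γ (Set.Icc 0 1) t) := by
    apply mfderiv_comp_mfderivWithin
    · exact mdifferentiableAt_extChartAt (hs t ht)
    · exact (hγ.mdifferentiable one_ne_zero).mdifferentiableOn _ ht
    · rwa [uniqueMDiffWithinAt_iff_uniqueDiffWithinAt]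
  have h3 : derivWithin (fun t ↦ K.symm (β t)) (Set.Icc 0 1) t =
      K.symm (mfderiv 𝓘(ℝ, E) 𝓘(ℝ, E) (extChartAt 𝓘(ℝ, E) x) (γ t)
        (mfderivWithin 𝓘(ℝ, ℝ) 𝓘(ℝ, E) γ (Set.Icc 0 1) t 1)) := by
    have h4 : HasDerivWithinAt β (derivWithin β (Set.Icc 0 1) t) (Set.Icc 0 1) t :=
      (hβs.differentiableOn one_ne_zero t ht).hasDerivWithinAt
    have h5 := (K.symm.toContinuousLinearMap.hasFDerivAt.comp_hasDerivWithinAt t h4).derivWithin hu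
    refine h5.trans ?_
    have h6 : mfderivWithin 𝓘(ℝ, ℝ) 𝓘(ℝ, E) β (Set.Icc 0 1) t 1 =
        derivWithin β (Set.Icc 0 1) t := by
      rw [mfderivWithin_eq_fderivWithin]
      exact fderivWithin_derivWithin (𝕜 := ℝ) (f := β) (s := Set.Icc 0 1) (x := t)
    rw [h2] at h6
    exact congrArg K.symm h6.symm
  rw [h3]
  have h7 := hK t ht (mfderivWithin 𝓘(ℝ, ℝ) 𝓘(ℝ, E) γ (Set.Icc 0 1) t 1)
  rw [← ofReal_norm, ← ofReal_norm, ← ENNReal.ofReal_mul hr]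
  exact ENNReal.ofReal_le_ofReal h7

/-- Lower bound for the Riemannian distance by the distance in an almost isometric chart. -/
theorem exists_nhds_enorm_chart_sub_le [RegularSpace M] {x : M}
    (K : TangentSpace 𝓘(ℝ, E) x ≃L[ℝ] E) {r : ℝ} (hr : 0 < r)
    (hK : ∀ᶠ y in 𝓝 x, ∀ v : TangentSpace 𝓘(ℝ, E) y,
      ‖K.symm (mfderiv 𝓘(ℝ, E) 𝓘(ℝ, E) (extChartAt 𝓘(ℝ, E) x) y v)‖ ≤ r * ‖v‖) :
    ∃ U ∈ 𝓝 x, ∀ p ∈ U, ∀ q ∈ U,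
      ‖K.symm (extChartAt 𝓘(ℝ, E) x p - extChartAt 𝓘(ℝ, E) x q)‖ₑ ≤
        ENNReal.ofReal r * riemannianEDist 𝓘(ℝ, E) p q := by
  -- Points within `c/3` of `x` are joined by almost shortest paths of length below `2c/3`. Such
  -- paths stay within `c` of `x`, where the chart estimate holds.
  obtain ⟨c, hc, hcs⟩ := setOfPred_riemannianEDist_lt_subset_nhds 𝓘(ℝ, E)
    (Filter.inter_mem hK (chart_source_mem_nhds E x))
  have hc3 : (0 : ENNReal) < (c / 3 : NNReal) := by
    rw [ENNReal.coe_pos]; positivity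
  refine ⟨_, eventually_riemannianEDist_lt 𝓘(ℝ, E) x hc3, fun p hp q hq ↦ ?_⟩
  simp only [Set.mem_ofPred_eq] at hp hq
  have hr0 : ENNReal.ofReal r ≠ 0 := by simpa using hr
  rw [← ENNReal.div_le_iff' hr0 ENNReal.ofReal_ne_top]
  refine le_of_forall_gt fun ρ hρ ↦ ?_
  have hqp : riemannianEDist 𝓘(ℝ, E) q p < min ρ ((c / 3 : NNReal) + (c / 3 : NNReal)) := by
    refine lt_min (by rwa [riemannianEDist_comm]) ?_
    refine (riemannianEDist_triangle (y := x)).trans_lt ?_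
    rw [riemannianEDist_comm (x := q)]
    exact ENNReal.add_lt_add hq hp
  obtain ⟨γ, h0, h1, hγ, hlen, -⟩ :=
    exists_lt_locally_constant_of_riemannianEDist_lt hqp zero_lt_one
  have hin : ∀ t ∈ Set.Icc (0 : ℝ) 1, γ t ∈ {y | riemannianEDist 𝓘(ℝ, E) x y < c} := by
    intro t ht
    calc riemannianEDist 𝓘(ℝ, E) x (γ t)
        ≤ riemannianEDist 𝓘(ℝ, E) x q + riemannianEDist 𝓘(ℝ, E) q (γ t) :=
          riemannianEDist_triangle
      _ ≤ riemannianEDist 𝓘(ℝ, E) x q + pathELength 𝓘(ℝ, E) γ 0 1 := by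
          gcongr
          exact (riemannianEDist_le_pathELength hγ.contMDiffOn h0 rfl ht.1).trans
            (pathELength_mono le_rfl ht.2)
      _ < (c / 3 : NNReal) + ((c / 3 : NNReal) + (c / 3 : NNReal)) :=
          ENNReal.add_lt_add hq (hlen.trans_le (min_le_right _ _))
      _ = c := by
          rw [← ENNReal.coe_add, ← ENNReal.coe_add]
          congr 1
          ext
          push_cast
          ring
  have h2 := enorm_chart_sub_le_pathELength K hr.le hγ (fun t ht ↦ (hcs (hin t ht)).2)
    (fun t ht ↦ (hcs (hin t ht)).1)
  rw [h0, h1] at h2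
  rw [← ENNReal.div_le_iff' hr0 ENNReal.ofReal_ne_top] at h2
  exact h2.trans_lt (hlen.trans_le (min_le_left _ _))

omit [IsContinuousRiemannianBundle E (fun x : M ↦ TangentSpace 𝓘(ℝ, E) x)] in
/-- Upper bound for the Riemannian distance by the distance in an almost isometric chart. -/
theorem exists_nhds_riemannianEDist_le_enorm_chart_sub {x : M}
    (K : TangentSpace 𝓘(ℝ, E) x ≃L[ℝ] E) {r : ℝ} (hr : 0 ≤ r)
    (hK : ∀ᶠ y in 𝓝 x, ∀ v : TangentSpace 𝓘(ℝ, E) y,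
      ‖v‖ ≤ r * ‖K.symm (mfderiv 𝓘(ℝ, E) 𝓘(ℝ, E) (extChartAt 𝓘(ℝ, E) x) y v)‖) :
    ∃ U ∈ 𝓝 x, ∀ p ∈ U, ∀ q ∈ U,
      riemannianEDist 𝓘(ℝ, E) p q ≤ ENNReal.ofReal r *
        ‖K.symm (extChartAt 𝓘(ℝ, E) x p - extChartAt 𝓘(ℝ, E) x q)‖ₑ := by
  obtain ⟨ρ, hρ, hball⟩ := Metric.mem_nhds_iff.1
    (Filter.inter_mem (extChartAt_target_mem_nhds (I := 𝓘(ℝ, E)) x)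
      (extChartAt_preimage_mem_nhds (I := 𝓘(ℝ, E)) hK))
  refine ⟨(chartAt E x).source ∩
    extChartAt 𝓘(ℝ, E) x ⁻¹' Metric.ball (extChartAt 𝓘(ℝ, E) x x) ρ,
    Filter.inter_mem (chart_source_mem_nhds E x)
      ((continuousAt_extChartAt x).preimage_mem_nhds (Metric.ball_mem_nhds _ hρ)),
    fun q hq p hp ↦ ?_⟩
  rw [riemannianEDist_comm]
  -- The competitor is the straight segment in the chart, which stays in a convex ball where the
  -- estimate holds.
  set η : ℝ → E := fun t ↦ AffineMap.lineMap (extChartAt 𝓘(ℝ, E) x p) (extChartAt 𝓘(ℝ, E) x q) t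
    with hη
  have hηd : ∀ t, HasDerivAt η (extChartAt 𝓘(ℝ, E) x q - extChartAt 𝓘(ℝ, E) x p) t := fun t ↦
    AffineMap.hasDerivAt_lineMap
  have hηs : ContMDiffOn 𝓘(ℝ, ℝ) 𝓘(ℝ, E) 1 η (Set.Icc 0 1) := by
    rw [contMDiffOn_iff_contDiffOn]
    exact (ContinuousAffineMap.lineMap (R := ℝ) (extChartAt 𝓘(ℝ, E) x p)
      (extChartAt 𝓘(ℝ, E) x q)).contDiff.contDiffOn
  have hηb : ∀ t ∈ Set.Icc (0 : ℝ) 1, η t ∈ Metric.ball (extChartAt 𝓘(ℝ, E) x x) ρ := by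
    intro t ht
    exact (convex_ball _ _).lineMap_mem hp.2 hq.2 ht
  set γ : ℝ → M := (extChartAt 𝓘(ℝ, E) x).symm ∘ η with hγ
  have hγs : ContMDiffOn 𝓘(ℝ, ℝ) 𝓘(ℝ, E) 1 γ (Set.Icc 0 1) :=
    (contMDiffOn_extChartAt_symm x).comp hηs fun t ht ↦ (hball (hηb t ht)).1
  refine (riemannianEDist_le_pathELength hγs (x := p) (y := q) ?_ ?_ zero_le_one).trans ?_
  · simp only [hγ, hη, Function.comp_apply, AffineMap.lineMap_apply_zero]
    exact (extChartAt 𝓘(ℝ, E) x).left_inv (by simpa using hp.1)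
  · simp only [hγ, hη, Function.comp_apply, AffineMap.lineMap_apply_one]
    exact (extChartAt 𝓘(ℝ, E) x).left_inv (by simpa using hq.1)
  rw [pathELength_eq_lintegral_mfderivWithin_Icc]
  have hbound : ∀ t ∈ Set.Icc (0 : ℝ) 1,
      ‖mfderivWithin 𝓘(ℝ, ℝ) 𝓘(ℝ, E) γ (Set.Icc 0 1) t 1‖ₑ ≤ ENNReal.ofReal r *
        ‖K.symm (extChartAt 𝓘(ℝ, E) x q - extChartAt 𝓘(ℝ, E) x p)‖ₑ := by
    intro t ht
    have hmem : γ t ∈ (extChartAt 𝓘(ℝ, E) x).source :=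
      (extChartAt 𝓘(ℝ, E) x).map_target (hball (hηb t ht)).1
    have hu : UniqueDiffWithinAt ℝ (Set.Icc (0 : ℝ) 1) t := uniqueDiffOn_Icc zero_lt_one t ht
    have hu' : UniqueMDiffWithinAt 𝓘(ℝ, ℝ) (Set.Icc (0 : ℝ) 1) t := by
      rwa [uniqueMDiffWithinAt_iff_uniqueDiffWithinAt]
    have h2 : mfderivWithin 𝓘(ℝ, ℝ) 𝓘(ℝ, E) (extChartAt 𝓘(ℝ, E) x ∘ γ) (Set.Icc 0 1) t =
        (mfderiv 𝓘(ℝ, E) 𝓘(ℝ, E) (extChartAt 𝓘(ℝ, E) x) (γ t)) ∘L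
          (mfderivWithin 𝓘(ℝ, ℝ) 𝓘(ℝ, E) γ (Set.Icc 0 1) t) := by
      apply mfderiv_comp_mfderivWithin
      · exact mdifferentiableAt_extChartAt (by simpa using hmem)
      · exact hγs.mdifferentiableOn one_ne_zero _ ht
      · exact hu'
    have h3 : Set.EqOn (extChartAt 𝓘(ℝ, E) x ∘ γ) η (Set.Icc 0 1) := fun t ht ↦
      (extChartAt 𝓘(ℝ, E) x).right_inv (hball (hηb t ht)).1
    have h4 : mfderivWithin 𝓘(ℝ, ℝ) 𝓘(ℝ, E) η (Set.Icc 0 1) t 1 =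
        extChartAt 𝓘(ℝ, E) x q - extChartAt 𝓘(ℝ, E) x p := by
      rw [mfderivWithin_eq_fderivWithin]
      exact (fderivWithin_derivWithin (𝕜 := ℝ) (f := η) (s := Set.Icc 0 1) (x := t)).trans ((hηd t).hasDerivWithinAt.derivWithin hu)
    have h5 : mfderiv 𝓘(ℝ, E) 𝓘(ℝ, E) (extChartAt 𝓘(ℝ, E) x) (γ t)
        (mfderivWithin 𝓘(ℝ, ℝ) 𝓘(ℝ, E) γ (Set.Icc 0 1) t 1) =
        extChartAt 𝓘(ℝ, E) x q - extChartAt 𝓘(ℝ, E) x p := by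
      rw [← h4, ← mfderivWithin_congr_of_mem h3 ht, h2]
      rfl
    have h6 := (hball (hηb t ht)).2 (mfderivWithin 𝓘(ℝ, ℝ) 𝓘(ℝ, E) γ (Set.Icc 0 1) t 1)
    rw [← ofReal_norm, ← ofReal_norm, ← ENNReal.ofReal_mul hr]
    refine (ENNReal.ofReal_le_ofReal h6).trans_eq ?_
    congr 3
    exact congrArg K.symm h5
  refine (setLIntegral_mono' measurableSet_Icc hbound).trans_eq ?_
  simp

end

/-! ### Increments of shortest curves for a bi-invariant distance. -/

/-- A bi-invariant extended distance on a group. -/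
structure IsBiinvariantEDist {G : Type*} [Group G] (d : G → G → ENNReal) : Prop where
  self : ∀ x, d x x = 0
  comm : ∀ x y, d x y = d y x
  triangle : ∀ x y z, d x z ≤ d x y + d y z
  eq_of_zero : ∀ x y, d x y = 0 → x = y
  mul_left : ∀ g x y, d (g * x) (g * y) = d x y
  mul_right : ∀ g x y, d (x * g) (y * g) = d x y

/-- `f` is a coordinate around the unit, with local inverse `g`, which is an isometry to first
order for the extended distance `d`, and for which the product is the sum to first order. -/
structure IsInfinitesimallyIsometric {G : Type*} [TopologicalSpace G] [Group G]
    {F : Type*} [NormedAddCommGroup F] (d : G → G → ENNReal) (f : G → F) (g : F → G) : Prop where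
  map_one : f 1 = 0
  symm_zero : g 0 = 1
  continuousAt_symm : ContinuousAt g 0
  right_inv : ∀ᶠ u in 𝓝 0, f (g u) = u
  mul : (fun p : G × G ↦ f (p.1 * p.2) - f p.1 - f p.2) =o[𝓝 (1, 1)] fun p ↦ (f p.1, f p.2)
  enorm_sub_le : ∀ r : ℝ, 1 < r → ∃ U ∈ 𝓝 (1 : G), ∀ p ∈ U, ∀ q ∈ U,
    ‖f p - f q‖ₑ ≤ ENNReal.ofReal r * d p q
  le_enorm_sub : ∀ r : ℝ, 1 < r → ∃ U ∈ 𝓝 (1 : G), ∀ p ∈ U, ∀ q ∈ U,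
    d p q ≤ ENNReal.ofReal r * ‖f p - f q‖ₑ
  small : ∀ U ∈ 𝓝 (1 : G), ∃ c : ℝ, 0 < c ∧ ∀ y, d 1 y < ENNReal.ofReal c → y ∈ U

section

variable {G : Type*} [TopologicalSpace G] [Group G] [ContinuousMul G]
    {F : Type*} [NormedAddCommGroup F] [InnerProductSpace ℝ F]
    {d : G → G → ENNReal} {f : G → F} {g : F → G}

/-- Quantitative strict convexity of the Euclidean ball. The last hypothesis gives `‖x + y‖ ≥ (2 -
5η)ρ`, and the parallelogram law bounds `‖x - y‖²` by `(4(1 + η)² - (2 - 5η)²)ρ² ≤ 28ηρ²`. -/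
theorem norm_sub_sq_le_of_le_norm_add {x y : F} {ρ η : ℝ} (hρ : 0 ≤ ρ) (hη : 0 ≤ η)
    (hη' : η ≤ 1 / 4) (hx : ‖x‖ ≤ (1 + η) * ρ) (hy : ‖y‖ ≤ (1 + η) * ρ)
    (h : 2 * ρ ≤ (1 + η) * (‖x + y‖ + 2 * η * ρ)) :
    ‖x - y‖ ^ 2 ≤ 28 * η * ρ ^ 2 := by
  have hp := parallelogram_law_with_norm ℝ x y
  have hS : (2 - 5 * η) * ρ ≤ ‖x + y‖ := by
    have h1 : (1 + η) * ((2 - 5 * η) * ρ) ≤ (1 + η) * ‖x + y‖ := by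
      nlinarith [mul_nonneg hη hρ, mul_nonneg (mul_nonneg hη hη) hρ]
    exact le_of_mul_le_mul_left h1 (by linarith)
  have hS2 : ((2 - 5 * η) * ρ) ^ 2 ≤ ‖x + y‖ ^ 2 :=
    pow_le_pow_left₀ (mul_nonneg (by linarith) hρ) hS 2
  have hx2 : ‖x‖ ^ 2 ≤ ((1 + η) * ρ) ^ 2 := pow_le_pow_left₀ (norm_nonneg _) hx 2
  have hy2 : ‖y‖ ^ 2 ≤ ((1 + η) * ρ) ^ 2 := pow_le_pow_left₀ (norm_nonneg _) hy 2
  nlinarith [sq_nonneg (η * ρ)]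

/-- Two elements at the same small distance `c * h` of the unit for which the path through the
corner cannot be shortened are close to each other to first order. -/
theorem IsInfinitesimallyIsometric.edist_le_of_no_shortcut
    (H : IsInfinitesimallyIsometric d f g) {c ε : ℝ} (hc : 0 ≤ c) (hε : 0 < ε) :
    ∃ δ > 0, ∀ h, 0 < h → h < δ → ∀ A B : G, d 1 A = ENNReal.ofReal (c * h) →
      d 1 B = ENNReal.ofReal (c * h) →
      (∀ a, ENNReal.ofReal (2 * (c * h)) ≤ d 1 (a * A) + d a B) →
      d A B ≤ ENNReal.ofReal (ε * h) := by
  -- Here `112 = 4 · 28`: the bound `28η(ch)²` on the squared coordinate difference, times `2² ≥ (1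
  -- + η)²` for passing back to `d`. The `+ 1` in the denominator covers `c = 0`.
  obtain ⟨η, hη, hη4, hηε⟩ : ∃ η : ℝ, 0 < η ∧ η ≤ 1 / 4 ∧ 112 * η * c ^ 2 ≤ ε ^ 2 := by
    refine ⟨min (1 / 4) (ε ^ 2 / (112 * c ^ 2 + 1)), by positivity, min_le_left _ _, ?_⟩
    have h1 : min (1 / 4) (ε ^ 2 / (112 * c ^ 2 + 1)) ≤ ε ^ 2 / (112 * c ^ 2 + 1) :=
      min_le_right _ _
    rw [le_div_iff₀ (by positivity)] at h1
    have h2 : 0 < min (1 / 4) (ε ^ 2 / (112 * c ^ 2 + 1)) := by positivity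
    nlinarith
  obtain ⟨U₁, hU₁, hlow⟩ := H.enorm_sub_le (1 + η) (by linarith)
  obtain ⟨U₂, hU₂, hupp⟩ := H.le_enorm_sub (1 + η) (by linarith)
  have hmul := H.mul.bound hη
  rw [nhds_prod_eq, Filter.eventually_prod_self_iff (r := fun a b : G ↦
    ‖f (a * b) - f a - f b‖ ≤ η * ‖(f a, f b)‖)] at hmul
  obtain ⟨V, hV, hmul⟩ := hmul
  have hmulU : ∀ᶠ p : G × G in 𝓝 (1 : G) ×ˢ 𝓝 (1 : G), p.1 * p.2 ∈ U₂ := by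
    rw [← nhds_prod_eq]
    have : Filter.Tendsto (fun p : G × G ↦ p.1 * p.2) (𝓝 (1, 1)) (𝓝 (1 * 1)) :=
      continuous_mul.tendsto _
    rw [one_mul] at this
    exact this hU₂
  rw [Filter.eventually_prod_self_iff (r := fun a b : G ↦ a * b ∈ U₂)] at hmulU
  obtain ⟨V', hV', hmulU⟩ := hmulU
  set W := U₁ ∩ U₂ ∩ V ∩ V' with hWdef
  have hW : W ∈ 𝓝 (1 : G) :=
    Filter.inter_mem (Filter.inter_mem (Filter.inter_mem hU₁ hU₂) hV) hV'
  obtain ⟨c₀, hc₀, hsmall⟩ := H.small W hW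
  have hg : ∀ᶠ u in 𝓝 (0 : F), g u ∈ W ∧ f (g u) = u :=
    (H.continuousAt_symm.eventually (by rw [H.symm_zero]; exact hW)).and H.right_inv
  obtain ⟨ρ, hρ, hg⟩ := Metric.eventually_nhds_iff_ball.1 hg
  refine ⟨min c₀ ρ / (2 * c + 1), by positivity, fun h h0 hh A B hA hB hab ↦ ?_⟩
  rw [lt_div_iff₀ (by positivity)] at hh
  have hch : 0 ≤ c * h := by positivity
  have hhc : 2 * (c * h) < min c₀ ρ := by nlinarith
  have hAW : A ∈ W := hsmall A (by
    rw [hA, ENNReal.ofReal_lt_ofReal_iff hc₀]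
    linarith [hhc.trans_le (min_le_left _ _)])
  have hBW : B ∈ W := hsmall B (by
    rw [hB, ENNReal.ofReal_lt_ofReal_iff hc₀]
    linarith [hhc.trans_le (min_le_left _ _)])
  have h1W : (1 : G) ∈ W := mem_of_mem_nhds hW
  have hnorm : ∀ X ∈ W, d 1 X = ENNReal.ofReal (c * h) → ‖f X‖ ≤ (1 + η) * (c * h) := by
    intro X hX hdX
    have := hlow 1 h1W.1.1.1 X hX.1.1.1
    rw [H.map_one, zero_sub, enorm_neg, hdX, ← ENNReal.ofReal_mul (by positivity),
      ← ofReal_norm, ENNReal.ofReal_le_ofReal_iff (by positivity)] at this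
    exact this
  have hfA := hnorm A hAW hA
  have hfB := hnorm B hBW hB
  have hle2 : (1 + η) * (c * h) ≤ 2 * (c * h) := by gcongr; linarith
  -- With this `a`, both `a * A` seen from `1` and `B` seen from `a` are displaced by about `(f A +
  -- f B) / 2`.
  set u : F := (2 : ℝ)⁻¹ • (f B - f A) with hu
  have hun : ‖u‖ ≤ 2 * (c * h) := by
    rw [hu, norm_smul, norm_inv, Real.norm_ofNat]
    linarith [norm_sub_le (f B) (f A)]
  obtain ⟨haW, hfa⟩ := hg u (by
    rw [mem_ball_zero_iff]
    exact hun.trans_lt (hhc.trans_le (min_le_right _ _)))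
  set a := g u with ha
  have haA : ‖f (a * A) - f a - f A‖ ≤ η * (2 * (c * h)) := by
    refine (hmul a haW.1.2 A hAW.1.2).trans ?_
    gcongr
    rw [Prod.norm_mk, hfa]
    exact max_le hun (hfA.trans hle2)
  have e1 : f (a * A) = (f (a * A) - f a - f A) + (2 : ℝ)⁻¹ • (f A + f B) := by
    rw [hfa, hu]; module
  have e2 : f a - f B = -((2 : ℝ)⁻¹ • (f A + f B)) := by
    rw [hfa, hu]; module
  have hhalf : ‖(2 : ℝ)⁻¹ • (f A + f B)‖ = ‖f A + f B‖ / 2 := by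
    rw [norm_smul, norm_inv, Real.norm_ofNat]; ring
  have d1 : d 1 (a * A) ≤
      ENNReal.ofReal ((1 + η) * (η * (2 * (c * h)) + ‖f A + f B‖ / 2)) := by
    have := hupp 1 h1W.1.1.2 (a * A) (hmulU a haW.2 A hAW.2)
    rw [H.map_one, zero_sub, enorm_neg, ← ofReal_norm, ← ENNReal.ofReal_mul (by positivity)]
      at this
    refine this.trans (ENNReal.ofReal_le_ofReal ?_)
    gcongr
    rw [e1]
    exact (norm_add_le _ _).trans (by rw [hhalf]; gcongr)
  have d2 : d a B ≤ ENNReal.ofReal ((1 + η) * (‖f A + f B‖ / 2)) := by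
    have := hupp a haW.1.1.2 B hBW.1.1.2
    rwa [e2, enorm_neg, ← ofReal_norm, hhalf, ← ENNReal.ofReal_mul (by positivity)] at this
  have hsum := (hab a).trans (add_le_add d1 d2)
  rw [← ENNReal.ofReal_add (by positivity) (by positivity),
    ENNReal.ofReal_le_ofReal_iff (by positivity)] at hsum
  have hsq := norm_sub_sq_le_of_le_norm_add hch hη.le hη4 hfA hfB (hsum.trans_eq (by ring))
  have := hupp A hAW.1.1.2 B hBW.1.1.2
  rw [← ofReal_norm, ← ENNReal.ofReal_mul (by positivity)] at this
  refine this.trans (ENNReal.ofReal_le_ofReal ?_)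
  have hfin : (2 * ‖f A - f B‖) ^ 2 ≤ (ε * h) ^ 2 := by
    nlinarith [mul_le_mul_of_nonneg_right hηε (sq_nonneg h)]
  have := abs_le_of_sq_le_sq hfin (by positivity)
  have h3 := (abs_le.1 this).2
  nlinarith [norm_nonneg (f A - f B)]

/-- The two increments are compared over `n` steps of length `T / n`; each step contributes `o(T /
n)`, so their distance is below every `ε * T`. -/
theorem IsBiinvariantEDist.increments_eq (hd : IsBiinvariantEDist d)
    (H : IsInfinitesimallyIsometric d f g) {c : ℝ} (hc : 0 ≤ c) {I : Set ℝ} (hI : I.OrdConnected)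
    {γ : ℝ → G} (hγ : ∀ s ∈ I, ∀ s' ∈ I, d (γ s) (γ s') = ENNReal.ofReal (c * |s - s'|))
    (s s' T : ℝ) (hT : 0 ≤ T) (hs : s ∈ I) (hsT : s + T ∈ I) (hs' : s' ∈ I) (hsT' : s' + T ∈ I) :
    γ (s + T) * (γ s)⁻¹ = γ (s' + T) * (γ s')⁻¹ := by
  wlog hlt : s < s' generalizing s s'
  · rcases (not_lt.1 hlt).lt_or_eq with h | h
    · exact (this s' s hs' hsT' hs hsT h).symm
    · rw [h]
  rcases hT.eq_or_lt with rfl | hT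
  · simp
  apply hd.eq_of_zero
  have main : ∀ ε : ℝ, 0 < ε →
      d (γ (s + T) * (γ s)⁻¹) (γ (s' + T) * (γ s')⁻¹) ≤ ENNReal.ofReal (ε * T) := by
    intro ε hε
    obtain ⟨δ, hδ, hkey⟩ := H.edist_le_of_no_shortcut hc hε
    -- The step `h = T / n` is below `δ` for the first-order estimate, and below `s' - s` so that `t
    -- + h < t'` in the broken path.
    obtain ⟨n, hn⟩ := exists_nat_gt (T / min δ (s' - s))
    have hm0 : 0 < min δ (s' - s) := by
      rw [lt_min_iff]; exact ⟨hδ, by linarith⟩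
    have hn0 : (0 : ℝ) < n := (by positivity : 0 < T / min δ (s' - s)).trans hn
    set h := T / n with hh
    have h0 : 0 < h := by positivity
    have hnh : n * h = T := by rw [hh]; field_simp
    have hhm : h < min δ (s' - s) := by
      rw [div_lt_iff₀ hm0] at hn
      rw [hh, div_lt_iff₀ hn0]
      linarith
    have hhs := hhm.trans_le (min_le_right _ _)
    have ind : ∀ k : ℕ, k ≤ n → d (γ (s + k * h) * (γ s)⁻¹) (γ (s' + k * h) * (γ s')⁻¹) ≤
        ENNReal.ofReal (k * (ε * h)) := by
      intro k
      induction k with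
      | zero => intro _; simp [hd.self]
      | succ k ih =>
        intro hk
        have hk' : (k : ℝ) + 1 ≤ n := by exact_mod_cast hk
        have hmem : ∀ x : ℝ, 0 ≤ x → x ≤ n → s + x * h ∈ I ∧ s' + x * h ∈ I := fun x h1 h2 ↦
          ⟨hI.out hs hsT ⟨by nlinarith, by nlinarith⟩,
            hI.out hs' hsT' ⟨by nlinarith, by nlinarith⟩⟩
        obtain ⟨m1, m1'⟩ := hmem k (by positivity) (by linarith)
        obtain ⟨m2, m2'⟩ := hmem (k + 1) (by positivity) hk'
        rw [add_mul, one_mul, ← add_assoc] at m2 m2'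
        rw [Nat.cast_succ, add_mul (k : ℝ) 1 h, one_mul, ← add_assoc, ← add_assoc]
        set t := s + k * h with ht
        set t' := s' + k * h with ht'
        have hd1 : ∀ x ∈ I, x + h ∈ I → d 1 (γ (x + h) * (γ x)⁻¹) = ENNReal.ofReal (c * h) := by
          intro x hx hxh
          rw [← hd.mul_right (γ x), one_mul, inv_mul_cancel_right, hγ x hx _ hxh,
            sub_add_cancel_left, abs_neg, abs_of_pos h0]
        have hAB : d (γ (t + h) * (γ t)⁻¹) (γ (t' + h) * (γ t')⁻¹) ≤ ENNReal.ofReal (ε * h) := by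
          refine hkey h h0 (hhm.trans_le (min_le_left _ _)) _ _ (hd1 t m1 m2) (hd1 t' m1' m2')
            fun a ↦ ?_
          have q1 : d 1 (a * (γ (t + h) * (γ t)⁻¹)) = d (γ t) (a * γ (t + h)) := by
            rw [← hd.mul_right (γ t), one_mul, ← mul_assoc, inv_mul_cancel_right]
          have q2 : d a (γ (t' + h) * (γ t')⁻¹) = d (a * γ t') (γ (t' + h)) := by
            rw [← hd.mul_right (γ t'), inv_mul_cancel_right]
          -- Broken path `γ t`, `a * γ (t + h)`, `a * γ t'`, `γ (t' + h)`. By left invariance its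
          -- middle leg has the finite length `c * (t' - t - h)`, cancelled below.
          have q3 := (hd.triangle (γ t) (a * γ t') (γ (t' + h))).trans
            (add_le_add_left (hd.triangle (γ t) (a * γ (t + h)) (a * γ t')) _)
          have htt : t + h < t' := by rw [ht, ht']; linarith
          rw [hd.mul_left, hγ _ m1 _ m2', hγ _ m2 _ m1', abs_of_neg (by linarith),
            abs_of_neg (by linarith)] at q3
          rw [q1, q2]
          have q4 : ENNReal.ofReal (c * -(t - (t' + h))) =
              ENNReal.ofReal (2 * (c * h)) + ENNReal.ofReal (c * -(t + h - t')) := by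
            rw [← ENNReal.ofReal_add (by positivity) (mul_nonneg hc (by linarith))]
            congr 1; ring
          rw [q4, add_right_comm (d _ _)] at q3
          exact (ENNReal.add_le_add_iff_right ENNReal.ofReal_ne_top).1 q3
        set A := γ (t + h) * (γ t)⁻¹ with hA
        set B := γ (t' + h) * (γ t')⁻¹ with hB
        have eA : γ (t + h) * (γ s)⁻¹ = A * (γ t * (γ s)⁻¹) := by rw [hA]; group
        have eB : γ (t' + h) * (γ s')⁻¹ = B * (γ t' * (γ s')⁻¹) := by rw [hB]; group
        rw [eA, eB]
        -- Changing one factor at a time: right invariance removes the common right factor, left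
        -- invariance the common left factor `B`.
        refine (hd.triangle _ (B * (γ t * (γ s)⁻¹)) _).trans ?_
        rw [hd.mul_right, hd.mul_left]
        refine (add_le_add hAB (ih (by omega))).trans_eq ?_
        rw [← ENNReal.ofReal_add (by positivity) (by positivity)]
        congr 1; ring
    have := ind n le_rfl
    rwa [hnh, show n * (ε * h) = ε * (n * h) by ring, hnh] at this
  refine le_antisymm (ENNReal.le_of_forall_pos_le_add fun ε hε _ ↦ ?_) zero_le
  have hεT : (0 : ℝ) < ε / T := by positivity
  refine (main (ε / T) hεT).trans_eq ?_
  rw [zero_add, div_mul_cancel₀ _ hT.ne', ENNReal.ofReal_coe_nnreal]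

end

/-! ### First-order geometry of a Lie group at the unit. -/

/-- Serves to carry the first-order product formula from the norm of the chart to the Riemannian
norm of the tangent space. -/
theorem ContinuousLinearEquiv.isBigO_prodMk_symm {X E F : Type*} [NormedAddCommGroup E]
    [NormedSpace ℝ E] [NormedAddCommGroup F] [NormedSpace ℝ F] (K : F ≃L[ℝ] E) (a b : X → E)
    (l : Filter X) :
    (fun x ↦ (a x, b x)) =O[l] fun x ↦ (K.symm (a x), K.symm (b x)) := by
  have h := (K.toContinuousLinearMap.prodMap K.toContinuousLinearMap).isBigO_comp
    (fun x ↦ (K.symm (a x), K.symm (b x))) l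
  simpa using h

section

open Manifold

variable {E : Type*} [NormedAddCommGroup E] [NormedSpace ℝ E]
  {G : Type*} [TopologicalSpace G] [ChartedSpace E G] [Group G] [LieGroup 𝓘(ℝ, E) ∞ G]

omit [Group G] [LieGroup 𝓘(ℝ, E) ∞ G] in
theorem isContinuousRiemannianBundle_tangentSpace [IsManifold 𝓘(ℝ, E) 1 G]
    [RiemannianBundle (fun x : G ↦ TangentSpace 𝓘(ℝ, E) x)]
    [h : IsContMDiffRiemannianBundle 𝓘(ℝ, E) ∞ E (fun x : G ↦ TangentSpace 𝓘(ℝ, E) x)] :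
    IsContinuousRiemannianBundle E (fun x : G ↦ TangentSpace 𝓘(ℝ, E) x) := by
  obtain ⟨g, hg, h⟩ := h.exists_contMDiff
  exact ⟨g, hg.continuous, h⟩

omit [Group G] [LieGroup 𝓘(ℝ, E) ∞ G] in
/-- A smooth isometric immersion does not increase the Riemannian distance. -/
theorem riemannianEDist_map_le [RiemannianBundle (fun x : G ↦ TangentSpace 𝓘(ℝ, E) x)]
    {Φ : G → G} (hΦ : ContMDiff 𝓘(ℝ, E) 𝓘(ℝ, E) ∞ Φ)
    (hn : ∀ (x : G) (v : TangentSpace 𝓘(ℝ, E) x),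
      ‖mfderiv 𝓘(ℝ, E) 𝓘(ℝ, E) Φ x v‖ = ‖v‖) (p q : G) :
    riemannianEDist 𝓘(ℝ, E) (Φ p) (Φ q) ≤ riemannianEDist 𝓘(ℝ, E) p q := by
  refine le_of_forall_gt fun r hr ↦ ?_
  obtain ⟨γ, h0, h1, hγ, hlen, -⟩ :=
    exists_lt_locally_constant_of_riemannianEDist_lt hr zero_lt_one
  refine lt_of_le_of_lt ?_ hlen
  refine (riemannianEDist_le_pathELength (γ := Φ ∘ γ) (a := 0) (b := 1)
    ((hΦ.of_le (by norm_cast)).comp hγ).contMDiffOn (by simp [h0]) (by simp [h1])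
    zero_le_one).trans_eq ?_
  rw [pathELength_eq_lintegral_mfderiv_Icc, pathELength_eq_lintegral_mfderiv_Icc]
  congr 1
  ext t
  rw [mfderiv_comp (I' := 𝓘(ℝ, E)) t (hΦ.mdifferentiable (by simp) _)
    (hγ.mdifferentiable one_ne_zero t)]
  rw [← ofReal_norm, ← ofReal_norm]
  exact congrArg ENNReal.ofReal (hn _ _)

/-- Translations do not increase lengths, and neither do their inverses. Points at distance zero
coincide because small metric balls lie in any given neighbourhood and the space is Hausdorff. -/
theorem riemannianEDist_isBiinvariantEDist [T2Space G]
    [RiemannianBundle (fun x : G ↦ TangentSpace 𝓘(ℝ, E) x)]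
    [IsContMDiffRiemannianBundle 𝓘(ℝ, E) ∞ E (fun x : G ↦ TangentSpace 𝓘(ℝ, E) x)]
    (hG : IsBiinvariantMetric E G) :
    IsBiinvariantEDist (riemannianEDist 𝓘(ℝ, E) : G → G → ENNReal) := by
  have : IsTopologicalGroup G := topologicalGroup_of_lieGroup 𝓘(ℝ, E) ∞
  have : IsContinuousRiemannianBundle E (fun x : G ↦ TangentSpace 𝓘(ℝ, E) x) :=
    isContinuousRiemannianBundle_tangentSpace
  have hl : ∀ g x y : G,
      riemannianEDist 𝓘(ℝ, E) (g * x) (g * y) ≤ riemannianEDist 𝓘(ℝ, E) x y := fun g x y ↦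
    riemannianEDist_map_le (contMDiff_mul_left (I := 𝓘(ℝ, E)) (n := ∞) (a := g)) (fun h v ↦ by
      rw [norm_eq_sqrt_real_inner, norm_eq_sqrt_real_inner, hG.1 g h v v]) x y
  have hr : ∀ g x y : G,
      riemannianEDist 𝓘(ℝ, E) (x * g) (y * g) ≤ riemannianEDist 𝓘(ℝ, E) x y := fun g x y ↦
    riemannianEDist_map_le (contMDiff_mul_right (I := 𝓘(ℝ, E)) (n := ∞) (a := g)) (fun h v ↦ by
      rw [norm_eq_sqrt_real_inner, norm_eq_sqrt_real_inner, hG.2 g h v v]) x y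
  refine ⟨fun x ↦ riemannianEDist_self, fun x y ↦ riemannianEDist_comm,
    fun x y z ↦ riemannianEDist_triangle, fun x y h ↦ ?_, fun g x y ↦ (hl g x y).antisymm ?_,
    fun g x y ↦ (hr g x y).antisymm ?_⟩
  · by_contra hne
    obtain ⟨c, hc, hsub⟩ := setOfPred_riemannianEDist_lt_subset_nhds 𝓘(ℝ, E)
      (isOpen_compl_singleton.mem_nhds (show x ∈ ({y}ᶜ : Set G) from hne))
    exact hsub (show riemannianEDist 𝓘(ℝ, E) x y < c by rw [h]; exact_mod_cast hc) rfl
  · simpa using hl g⁻¹ (g * x) (g * y)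
  · simpa using hr g⁻¹ (x * g) (y * g)

variable (E G) in
/-- The product of a Lie group, read in the chart at the unit, is smooth at the unit. -/
theorem contDiffAt_mul_extChartAt :
    ContDiffAt ℝ ∞ (fun p : E × E ↦ extChartAt 𝓘(ℝ, E) (1 : G)
      ((extChartAt 𝓘(ℝ, E) (1 : G)).symm p.1 * (extChartAt 𝓘(ℝ, E) (1 : G)).symm p.2))
      (extChartAt 𝓘(ℝ, E) (1 : G) 1, extChartAt 𝓘(ℝ, E) (1 : G) 1) := by
  set χ := extChartAt 𝓘(ℝ, E) (1 : G) with hχ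
  set x₀ := χ 1 with hx₀
  have hx₀s : χ.symm x₀ = 1 := by simp [hχ, hx₀]
  have hsymm : ContMDiffAt 𝓘(ℝ, E) 𝓘(ℝ, E) ∞ χ.symm x₀ :=
    (contMDiffOn_extChartAt_symm (1 : G)).contMDiffAt (extChartAt_target_mem_nhds (1 : G))
  have h1 : ContMDiffAt 𝓘(ℝ, E × E) 𝓘(ℝ, E) ∞ (fun p : E × E ↦ χ.symm p.1) (x₀, x₀) :=
    ContMDiffAt.comp (x₀, x₀) (I' := 𝓘(ℝ, E)) (g := χ.symm) (f := Prod.fst) hsymm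
      contDiff_fst.contMDiff.contMDiffAt
  have h2 : ContMDiffAt 𝓘(ℝ, E × E) 𝓘(ℝ, E) ∞ (fun p : E × E ↦ χ.symm p.2) (x₀, x₀) :=
    ContMDiffAt.comp (x₀, x₀) (I' := 𝓘(ℝ, E)) (g := χ.symm) (f := Prod.snd) hsymm
      contDiff_snd.contMDiff.contMDiffAt
  rw [← contMDiffAt_iff_contDiffAt]
  refine ContMDiffAt.comp (x₀, x₀) (I' := 𝓘(ℝ, E)) (g := χ) ?_ (h1.mul h2)
  simp only [hx₀s, mul_one]
  exact contMDiffAt_extChartAt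

variable (E G) in
/-- In a chart at the unit, the product of a Lie group is the sum to first order. -/
theorem extChartAt_mul_isLittleO :
    (fun p : G × G ↦ extChartAt 𝓘(ℝ, E) (1 : G) (p.1 * p.2) - extChartAt 𝓘(ℝ, E) (1 : G) p.1 -
      extChartAt 𝓘(ℝ, E) (1 : G) p.2 + extChartAt 𝓘(ℝ, E) (1 : G) 1) =o[𝓝 (1, 1)]
    fun p ↦ (extChartAt 𝓘(ℝ, E) (1 : G) p.1 - extChartAt 𝓘(ℝ, E) (1 : G) 1,
      extChartAt 𝓘(ℝ, E) (1 : G) p.2 - extChartAt 𝓘(ℝ, E) (1 : G) 1) := by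
  set χ := extChartAt 𝓘(ℝ, E) (1 : G) with hχ
  set x₀ := χ 1 with hx₀
  have hx₀s : χ.symm x₀ = 1 := by simp [hχ, hx₀]
  have hright : ∀ᶠ u in 𝓝 x₀, χ (χ.symm u) = u := by
    filter_upwards [extChartAt_target_mem_nhds (I := 𝓘(ℝ, E)) (1 : G)] with u hu
    exact χ.right_inv hu
  set m : E × E → E := fun p ↦ χ (χ.symm p.1 * χ.symm p.2) with hm
  have hm₀ : m (x₀, x₀) = x₀ := by
    simp only [hm, hx₀s, mul_one]
    exact hx₀.symm
  have hD := ((contDiffAt_mul_extChartAt E G).differentiableAt (by simp)).hasFDerivAt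
  change HasFDerivAt m (fderiv ℝ m (x₀, x₀)) (x₀, x₀) at hD
  set D := fderiv ℝ m (x₀, x₀) with hDdef
  -- Multiplication by the unit is the identity on each axis, so the derivative of the product is
  -- addition.
  have hD1 : ∀ a, D (a, 0) = a := by
    have h1 : HasFDerivAt (fun u : E ↦ (u, x₀)) (ContinuousLinearMap.inl ℝ E E) x₀ :=
      hasFDerivAt_prodMk_left x₀ x₀
    have h2 : HasFDerivAt (fun u ↦ m (u, x₀)) (D.comp (ContinuousLinearMap.inl ℝ E E)) x₀ :=
      HasFDerivAt.comp (f := fun u : E ↦ (u, x₀)) x₀ hD h1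
    have h3 : HasFDerivAt (fun u ↦ m (u, x₀)) (ContinuousLinearMap.id ℝ E) x₀ := by
      refine (hasFDerivAt_id x₀).congr_of_eventuallyEq ?_
      filter_upwards [hright] with u hu
      simp [hm, hx₀s, hu]
    intro a
    simpa using congrArg (fun L : E →L[ℝ] E ↦ L a) (h2.unique h3)
  have hD2 : ∀ a, D (0, a) = a := by
    have h1 : HasFDerivAt (fun u : E ↦ (x₀, u)) (ContinuousLinearMap.inr ℝ E E) x₀ :=
      hasFDerivAt_prodMk_right x₀ x₀
    have h2 : HasFDerivAt (fun u ↦ m (x₀, u)) (D.comp (ContinuousLinearMap.inr ℝ E E)) x₀ :=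
      HasFDerivAt.comp (f := fun u : E ↦ (x₀, u)) x₀ hD h1
    have h3 : HasFDerivAt (fun u ↦ m (x₀, u)) (ContinuousLinearMap.id ℝ E) x₀ := by
      refine (hasFDerivAt_id x₀).congr_of_eventuallyEq ?_
      filter_upwards [hright] with u hu
      simp [hm, hx₀s, hu]
    intro a
    simpa using congrArg (fun L : E →L[ℝ] E ↦ L a) (h2.unique h3)
  have hD3 : ∀ a b, D (a, b) = a + b := by
    intro a b
    rw [← hD1 a, ← hD2 b, ← map_add, hD1, hD2]
    simp
  have hχc : Filter.Tendsto χ (𝓝 1) (𝓝 x₀) := continuousAt_extChartAt (1 : G)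
  have ht : Filter.Tendsto (fun p : G × G ↦ (χ p.1, χ p.2)) (𝓝 (1, 1)) (𝓝 (x₀, x₀)) := by
    rw [nhds_prod_eq, nhds_prod_eq]
    exact hχc.prodMap hχc
  have hlo := (hasFDerivAt_iff_isLittleO.1 hD).comp_tendsto ht
  have hleft : ∀ᶠ a in 𝓝 (1 : G), χ.symm (χ a) = a := by
    filter_upwards [extChartAt_source_mem_nhds (I := 𝓘(ℝ, E)) (1 : G)] with u hu
    exact χ.left_inv hu
  refine hlo.congr' ?_ (Filter.Eventually.of_forall fun p ↦ by simp)
  rw [nhds_prod_eq]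
  filter_upwards [hleft.prod_mk hleft] with p hp
  simp only [Function.comp_apply, Prod.mk_sub_mk, hD3, hm₀]
  simp only [hm, hp.1, hp.2]
  abel

/-- The coordinate around the unit of a Lie group, with values in the tangent space at the unit,
is an infinitesimal isometry. -/
theorem exists_isInfinitesimallyIsometric
    [RiemannianBundle (fun x : G ↦ TangentSpace 𝓘(ℝ, E) x)]
    [IsContMDiffRiemannianBundle 𝓘(ℝ, E) ∞ E (fun x : G ↦ TangentSpace 𝓘(ℝ, E) x)] :
    ∃ K : TangentSpace 𝓘(ℝ, E) (1 : G) ≃L[ℝ] E,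
      IsInfinitesimallyIsometric (riemannianEDist 𝓘(ℝ, E))
        (fun y ↦ K.symm (extChartAt 𝓘(ℝ, E) (1 : G) y - extChartAt 𝓘(ℝ, E) (1 : G) 1))
        (fun u ↦ (extChartAt 𝓘(ℝ, E) (1 : G)).symm (extChartAt 𝓘(ℝ, E) (1 : G) 1 + K u)) ∧
      ∀ v : TangentSpace 𝓘(ℝ, E) (1 : G),
        ‖K.symm (mfderiv 𝓘(ℝ, E) 𝓘(ℝ, E) (extChartAt 𝓘(ℝ, E) (1 : G)) 1 v)‖ = ‖v‖ := by
  have : IsTopologicalGroup G := topologicalGroup_of_lieGroup 𝓘(ℝ, E) ∞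
  have : IsContinuousRiemannianBundle E (fun x : G ↦ TangentSpace 𝓘(ℝ, E) x) :=
    isContinuousRiemannianBundle_tangentSpace
  obtain ⟨K, hK⟩ := exists_almost_isometric_chart (E := E) (1 : G)
  have ht : Filter.Tendsto (fun u ↦ extChartAt 𝓘(ℝ, E) (1 : G) 1 + K u) (𝓝 0)
      (𝓝 (extChartAt 𝓘(ℝ, E) (1 : G) 1)) := by
    have : Continuous fun u ↦ extChartAt 𝓘(ℝ, E) (1 : G) 1 + K u := by fun_prop
    simpa using this.tendsto 0
  refine ⟨K, ⟨by simp, by simp, ?_, ?_, ?_, fun r hr ↦ ?_, fun r hr ↦ ?_, fun U hU ↦ ?_⟩,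
    fun v ↦ ?_⟩
  · have h := continuousAt_extChartAt_symm (I := 𝓘(ℝ, E)) (1 : G)
    rw [ContinuousAt] at h ⊢
    simp only [map_zero, add_zero, extChartAt_to_inv] at h ⊢
    exact h.comp ht
  · filter_upwards [ht (extChartAt_target_mem_nhds (I := 𝓘(ℝ, E)) (1 : G))] with u hu
    rw [(extChartAt 𝓘(ℝ, E) (1 : G)).right_inv hu]
    simp
  · have h1 := extChartAt_mul_isLittleO E G
    have h2 := (K.symm.toContinuousLinearMap.isBigO_comp _ _).trans_isLittleO h1
    have h3 := K.isBigO_prodMk_symm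
      (fun p : G × G ↦ extChartAt 𝓘(ℝ, E) (1 : G) p.1 - extChartAt 𝓘(ℝ, E) (1 : G) 1)
      (fun p : G × G ↦ extChartAt 𝓘(ℝ, E) (1 : G) p.2 - extChartAt 𝓘(ℝ, E) (1 : G) 1) (𝓝 (1, 1))
    simp only [ContinuousLinearEquiv.coe_coe] at h2
    refine (h2.trans_isBigO h3).congr_left fun p ↦ ?_
    simp only [← map_sub]
    congr 1
    abel
  · obtain ⟨U, hU, h⟩ := exists_nhds_enorm_chart_sub_le K (zero_lt_one.trans hr)
      ((hK r hr).mono fun y hy v ↦ (hy v).1)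
    refine ⟨U, hU, fun p hp q hq ↦ ?_⟩
    rw [← map_sub, sub_sub_sub_cancel_right]
    exact h p hp q hq
  · obtain ⟨U, hU, h⟩ := exists_nhds_riemannianEDist_le_enorm_chart_sub K (zero_lt_one.trans hr).le
      ((hK r hr).mono fun y hy v ↦ (hy v).2)
    refine ⟨U, hU, fun p hp q hq ↦ ?_⟩
    rw [← map_sub, sub_sub_sub_cancel_right]
    exact h p hp q hq
  · obtain ⟨c, hc, hsub⟩ := setOfPred_riemannianEDist_lt_subset_nhds 𝓘(ℝ, E) hU
    refine ⟨c, hc, fun y hy ↦ hsub ?_⟩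
    rwa [ENNReal.ofReal_coe_nnreal] at hy
  -- At the base point itself the estimates hold for every `r > 1`; letting `r` tend to `1` gives an
  -- isometry.
  · have h : ∀ r : ℝ, 1 < r → _ := fun r hr ↦ (hK r hr).self_of_nhds v
    refine le_antisymm ?_ ?_
    · refine ge_of_tendsto (f := fun r : ℝ ↦ r * ‖v‖) (x := 𝓝[>] 1) ?_
        (by filter_upwards [self_mem_nhdsWithin] with r hr using (h r hr).1)
      refine tendsto_nhdsWithin_of_tendsto_nhds ?_
      simpa using (continuous_id.mul continuous_const).tendsto (1 : ℝ) (f := fun r : ℝ ↦ r * ‖v‖)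
    · refine ge_of_tendsto (f := fun r : ℝ ↦ r * ‖K.symm
        (mfderiv 𝓘(ℝ, E) 𝓘(ℝ, E) (extChartAt 𝓘(ℝ, E) (1 : G)) 1 v)‖) (x := 𝓝[>] 1) ?_
        (by filter_upwards [self_mem_nhdsWithin] with r hr using (h r hr).2)
      refine tendsto_nhdsWithin_of_tendsto_nhds ?_
      have : Continuous fun r : ℝ ↦ r * ‖K.symm
        (mfderiv 𝓘(ℝ, E) 𝓘(ℝ, E) (extChartAt 𝓘(ℝ, E) (1 : G)) 1 v)‖ := by fun_prop
      simpa using this.tendsto 1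

end

/-! ### Smoothness of differentiable homomorphisms. -/

/-- A solution of an autonomous differential equation is one step smoother than the equation. -/
theorem contDiffOn_of_hasDerivAt_comp {E : Type*} [NormedAddCommGroup E] [NormedSpace ℝ E]
    {s : Set ℝ} (hs : IsOpen s) {β : ℝ → E} {V : E → E} {n : ℕ}
    (hβ : ∀ t ∈ s, HasDerivAt β (V (β t)) t) (hV : ∀ t ∈ s, ContDiffAt ℝ n V (β t)) :
    ContDiffOn ℝ (n + 1) β s := by
  have hd : DifferentiableOn ℝ β s := fun t ht ↦
    (hβ t ht).differentiableAt.differentiableWithinAt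
  have step : ∀ k : ℕ, k ≤ n → ContDiffOn ℝ k β s → ContDiffOn ℝ (k + 1) β s := by
    intro k hk h
    rw [contDiffOn_succ_iff_deriv_of_isOpen hs]
    refine ⟨hd, by simp, ?_⟩
    have h1 : ContDiffOn ℝ k (fun t ↦ V (β t)) s := fun t ht ↦
      ((hV t ht).of_le (by exact_mod_cast hk)).comp_contDiffWithinAt t (h t ht)
    exact h1.congr fun t ht ↦ (hβ t ht).deriv
  have all : ∀ k : ℕ, k ≤ n → ContDiffOn ℝ k β s := by
    intro k
    induction k with
    | zero => intro _; exact contDiffOn_zero.2 hd.continuousOn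
    | succ k ih => intro hk; exact_mod_cast step k (by omega) (ih (by omega))
  exact step n le_rfl (all n le_rfl)

section

open Manifold

variable {E : Type*} [NormedAddCommGroup E] [NormedSpace ℝ E]
  {G : Type*} [TopologicalSpace G] [ChartedSpace E G] [Group G] [LieGroup 𝓘(ℝ, E) ∞ G]

/-- A homomorphism from `ℝ` to a Lie group which is differentiable at one point is differentiable
everywhere. -/
theorem mdifferentiable_of_hom {φ : ℝ → G} (hφ : ∀ s t, φ (s + t) = φ s * φ t) {t₀ : ℝ}
    (h : MDifferentiableAt 𝓘(ℝ, ℝ) 𝓘(ℝ, E) φ t₀) : MDifferentiable 𝓘(ℝ, ℝ) 𝓘(ℝ, E) φ := by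
  intro t
  have e : φ = (fun x : G ↦ x * φ (t - t₀)) ∘ φ ∘ (fun s : ℝ ↦ s + (t₀ - t)) := by
    ext s
    simp only [Function.comp_apply]
    rw [← hφ]
    congr 1; ring
  rw [e]
  have h1 : MDifferentiableAt 𝓘(ℝ, ℝ) 𝓘(ℝ, ℝ) (fun s : ℝ ↦ s + (t₀ - t)) t := by
    rw [mdifferentiableAt_iff_differentiableAt]
    fun_prop
  have h2 : MDifferentiableAt 𝓘(ℝ, ℝ) 𝓘(ℝ, E) φ ((fun s : ℝ ↦ s + (t₀ - t)) t) := by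
    simpa using h
  exact ((contMDiff_mul_right (I := 𝓘(ℝ, E)) (n := ∞)).mdifferentiable (by simp) _).comp t
    (h2.comp t h1)

/-- A differentiable homomorphism from `ℝ` is an integral curve of a right-invariant field. -/
theorem isMIntegralCurve_of_hom {φ : ℝ → G} (hφ : ∀ s t, φ (s + t) = φ s * φ t)
    {L : ℝ →L[ℝ] TangentSpace 𝓘(ℝ, E) (1 : G)}
    (h : HasMFDerivAt 𝓘(ℝ, ℝ) 𝓘(ℝ, E) φ 0 L) :
    IsMIntegralCurve φ (rightInvariantField (L 1)) := by
  intro t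
  -- The points `t - t` and `φ (t - t)` equal `0` and `1` only propositionally, so the derivatives
  -- are stated at any point equal to these.
  have h1 : ∀ s : ℝ, s = 0 → HasMFDerivAt 𝓘(ℝ, ℝ) 𝓘(ℝ, E) φ s L := by
    rintro s rfl; exact h
  have h2 : ∀ x : G, x = 1 → HasMFDerivAt 𝓘(ℝ, E) 𝓘(ℝ, E) (fun y : G ↦ y * φ t) x
      (mfderiv 𝓘(ℝ, E) 𝓘(ℝ, E) (fun y : G ↦ y * φ t) 1) := by
    rintro x rfl
    exact ((contMDiff_mul_right (I := 𝓘(ℝ, E)) (n := ∞)).mdifferentiable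
      (by simp) _).hasMFDerivAt
  have h3 : HasMFDerivAt 𝓘(ℝ, ℝ) 𝓘(ℝ, ℝ) (fun s : ℝ ↦ s - t) t (ContinuousLinearMap.id ℝ ℝ) :=
    ((hasFDerivAt_id t).sub_const t).hasMFDerivAt
  have h4 := (h2 (φ (t - t)) (by rw [sub_self, hom_zero hφ])).comp t
    (HasMFDerivAt.comp (f := fun s : ℝ ↦ s - t) t (h1 (t - t) (sub_self t)) h3)
  have e : (fun y : G ↦ y * φ t) ∘ φ ∘ (fun s : ℝ ↦ s - t) = φ := by
    ext s
    simp only [Function.comp_apply]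
    rw [← hφ, sub_add_cancel]
  rw [e] at h4
  refine h4.congr_mfderiv ?_
  refine ContinuousLinearMap.ext_ring ?_
  have h5 : ((1 : ℝ →L[ℝ] ℝ).smulRight (rightInvariantField (L 1) (φ t))) 1 =
      rightInvariantField (L 1) (φ t) := by simp
  exact h5.symm

/-- A differentiable homomorphism from `ℝ` to a Lie group is smooth. -/
theorem contMDiff_of_hom {φ : ℝ → G} (hφ : ∀ s t, φ (s + t) = φ s * φ t)
    (h : MDifferentiable 𝓘(ℝ, ℝ) 𝓘(ℝ, E) φ) : ContMDiff 𝓘(ℝ, ℝ) 𝓘(ℝ, E) ∞ φ := by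
  set χ := extChartAt 𝓘(ℝ, E) (1 : G) with hχ
  set x₀ := χ 1 with hx₀
  have hx₀s : χ.symm x₀ = 1 := by simp [hχ, hx₀]
  set β : ℝ → E := χ ∘ φ with hβ
  have hφ0 := hom_zero hφ
  have hβ0 : β 0 = x₀ := by simp [hβ, hφ0, hx₀]
  have hsrc : ∀ᶠ t in 𝓝 (0 : ℝ), φ t ∈ χ.source := by
    have : Filter.Tendsto φ (𝓝 0) (𝓝 1) := by simpa [hφ0] using h.continuous.tendsto 0
    exact this (extChartAt_source_mem_nhds (1 : G))
  have hβc : Filter.Tendsto β (𝓝 0) (𝓝 x₀) := by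
    have : Filter.Tendsto φ (𝓝 0) (𝓝 1) := by simpa [hφ0] using h.continuous.tendsto 0
    exact (continuousAt_extChartAt (1 : G)).tendsto.comp this
  have hβd : DifferentiableAt ℝ β 0 := by
    rw [← mdifferentiableAt_iff_differentiableAt]
    refine MDifferentiableAt.comp (I' := 𝓘(ℝ, E)) (g := χ) 0 ?_ (h 0)
    exact mdifferentiableAt_extChartAt (by simp [hφ0])
  set m : E × E → E := fun p ↦ χ (χ.symm p.1 * χ.symm p.2) with hm
  have hmd : ContDiffAt ℝ ∞ m (x₀, x₀) := contDiffAt_mul_extChartAt E G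
  set w := deriv β 0 with hw
  -- Differentiating `β (s + t) = m (β s, β t)` in `s` at `0` gives the equation `β' = V ∘ β` near
  -- `0`.
  set V : E → E := fun v ↦ fderiv ℝ m (x₀, v) (w, 0) with hV
  -- Each finite order is treated separately, since the neighbourhood on which `m` is that smooth
  -- may depend on `n`.
  have key : ∀ n : ℕ, ContDiffAt ℝ (n + 1) β 0 := by
    intro n
    have hmn : ContDiffAt ℝ ((n + 1 : ℕ) : ℕ∞ω) m (x₀, x₀) := hmd.of_le (by exact_mod_cast le_top)
    have hev := hmn.eventually (by simp)
    have ht : Filter.Tendsto (fun v : E ↦ (x₀, v)) (𝓝 x₀) (𝓝 (x₀, x₀)) :=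
      (Continuous.prodMk_right x₀).tendsto x₀
    have hall : ∀ᶠ t in 𝓝 (0 : ℝ), HasDerivAt β (V (β t)) t ∧ ContDiffAt ℝ n V (β t) := by
      filter_upwards [hsrc, hβc.eventually (ht.eventually hev)] with t hts hmt
      constructor
      · have h1 : HasDerivAt (fun s : ℝ ↦ (β s, β t)) (w, 0) 0 :=
          hβd.hasDerivAt.prodMk (hasDerivAt_const _ _)
        have h2 : HasFDerivAt m (fderiv ℝ m (x₀, β t)) (β 0, β t) := by
          rw [hβ0]
          exact (hmt.differentiableAt (by simp)).hasFDerivAt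
        have h3 : HasDerivAt (fun s ↦ m (β s, β t)) (V (β t)) 0 :=
          HasFDerivAt.comp_hasDerivAt (f := fun s : ℝ ↦ (β s, β t)) 0 h2 h1
        have h4 : HasDerivAt (fun s ↦ β (s + t)) (V (β t)) 0 := by
          refine h3.congr_of_eventuallyEq ?_
          filter_upwards [hsrc] with s hs
          simp only [hm, hβ, Function.comp_apply, χ.left_inv hs, χ.left_inv hts, hφ]
        have h5 : HasDerivAt (fun s : ℝ ↦ s - t) 1 t := (hasDerivAt_id t).sub_const t
        have h6 := HasDerivAt.scomp (g₁ := fun s ↦ β (s + t)) (h := fun s ↦ s - t) t (by simpa using h4) h5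
        simpa [Function.comp_def] using h6
      · have h1 : ContDiffAt ℝ n (fderiv ℝ m) (x₀, β t) := hmt.fderiv_right (by norm_cast)
        have h2 : ContDiffAt ℝ n (fun v ↦ fderiv ℝ m (x₀, v)) (β t) :=
          ContDiffAt.comp (g := fderiv ℝ m) (f := fun v ↦ (x₀, v)) (β t) h1 (by fun_prop)
        exact h2.clm_apply contDiffAt_const
    obtain ⟨s, hs, hso, h0s⟩ := eventually_nhds_iff.1 hall
    exact (contDiffOn_of_hasDerivAt_comp hso (fun t ht ↦ (hs t ht).1)
      (fun t ht ↦ (hs t ht).2)).contDiffAt (hso.mem_nhds h0s)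
  have hβs : ContDiffAt ℝ ∞ β 0 := by
    rw [contDiffAt_infty]
    exact fun n ↦ (key n).of_le (by exact_mod_cast n.le_succ)
  have hφs : ContMDiffAt 𝓘(ℝ, ℝ) 𝓘(ℝ, E) ∞ φ 0 := by
    have hsymm : ContMDiffAt 𝓘(ℝ, E) 𝓘(ℝ, E) ∞ χ.symm (β 0) := by
      rw [hβ0]
      exact (contMDiffOn_extChartAt_symm (1 : G)).contMDiffAt (extChartAt_target_mem_nhds (1 : G))
    refine (ContMDiffAt.comp (0 : ℝ) hsymm hβs.contMDiffAt).congr_of_eventuallyEq ?_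
    filter_upwards [hsrc] with t ht
    exact (χ.left_inv ht).symm
  intro t
  have e : φ = (fun x : G ↦ x * φ t) ∘ φ ∘ (fun s : ℝ ↦ s - t) := by
    ext s
    simp only [Function.comp_apply]
    rw [← hφ, sub_add_cancel]
  rw [e]
  have h1 : ContMDiffAt 𝓘(ℝ, ℝ) 𝓘(ℝ, ℝ) ∞ (fun s : ℝ ↦ s - t) t :=
    (contDiff_id.sub contDiff_const).contMDiff.contMDiffAt
  have h2 : ContMDiffAt 𝓘(ℝ, ℝ) 𝓘(ℝ, E) ∞ φ ((fun s : ℝ ↦ s - t) t) := by simpa using hφs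
  exact (contMDiff_mul_right (I := 𝓘(ℝ, E)) (n := ∞)).contMDiffAt.comp t
    (ContMDiffAt.comp (f := fun s : ℝ ↦ s - t) t h2 h1)

end

/-! ### Differentiability and speed of curves of constant metric speed. -/

section

variable {G : Type*} [TopologicalSpace G] [Group G]
    {F : Type*} [NormedAddCommGroup F] [NormedSpace ℝ F]
    {d : G → G → ENNReal} {f : G → F} {g : F → G} {φ : ℝ → G} {c δ : ℝ}

omit [NormedSpace ℝ F] in
theorem IsInfinitesimallyIsometric.tendsto_curve (H : IsInfinitesimallyIsometric d f g)
    (hφ0 : φ 0 = 1) (hδ : 0 < δ)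
    (hφ : ∀ s t : ℝ, |s| < δ → |t| < δ → d (φ s) (φ t) = ENNReal.ofReal (c * |s - t|)) :
    Filter.Tendsto φ (𝓝 0) (𝓝 1) := by
  intro U hU
  obtain ⟨c₀, hc₀, hsub⟩ := H.small U hU
  have h1 : Filter.Tendsto (fun t : ℝ ↦ c * |t|) (𝓝 0) (𝓝 0) := by
    have : Continuous fun t : ℝ ↦ c * |t| := by fun_prop
    simpa using this.tendsto 0
  have h2 : Filter.Tendsto (fun t : ℝ ↦ |t|) (𝓝 0) (𝓝 0) := by
    simpa using (continuous_abs (G := ℝ)).tendsto 0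
  change φ ⁻¹' U ∈ 𝓝 0
  filter_upwards [h1.eventually_lt_const hc₀, h2.eventually_lt_const hδ] with t ht1 ht2
  apply hsub
  rw [← hφ0, hφ 0 t (by simpa using hδ) ht2, zero_sub, abs_neg]
  exact (ENNReal.ofReal_lt_ofReal_iff hc₀).2 ht1

/-- A curve of constant speed is differentiable, in coordinates, at points arbitrarily close
to `0`. -/
theorem IsInfinitesimallyIsometric.exists_differentiableAt [FiniteDimensional ℝ F]
    (H : IsInfinitesimallyIsometric d f g) (hφ0 : φ 0 = 1) (hδ : 0 < δ) (hc : 0 ≤ c)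
    (hφ : ∀ s t : ℝ, |s| < δ → |t| < δ → d (φ s) (φ t) = ENNReal.ofReal (c * |s - t|))
    {W : Set ℝ} (hW : W ∈ 𝓝 0) : ∃ t ∈ W, DifferentiableAt ℝ (f ∘ φ) t := by
  obtain ⟨U, hU, hlow⟩ := H.enorm_sub_le 2 one_lt_two
  have hU' := H.tendsto_curve hφ0 hδ hφ hU
  obtain ⟨ρ, hρ, hball⟩ := Metric.mem_nhds_iff.1
    (Filter.inter_mem (Filter.inter_mem hU' hW) (Metric.ball_mem_nhds (0 : ℝ) hδ))
  -- Coordinates are bounded by twice `d`, so the curve is Lipschitz in coordinates and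
  -- differentiable almost everywhere on a ball of positive measure.
  have hlip : LipschitzOnWith (2 * c).toNNReal (f ∘ φ) (Metric.ball 0 ρ) := by
    intro s hs t ht
    have hsδ : |s| < δ := by simpa using (hball hs).2
    have htδ : |t| < δ := by simpa using (hball ht).2
    have h1 := hlow _ (hball hs).1.1 _ (hball ht).1.1
    rw [hφ s t hsδ htδ, ← ENNReal.ofReal_mul zero_le_two] at h1
    rw [edist_eq_enorm_sub, edist_dist, Real.dist_eq]
    refine h1.trans_eq ?_
    rw [← mul_assoc, ENNReal.ofReal_mul (by positivity)]
    rfl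
  have hae := hlip.ae_differentiableWithinAt_real Metric.isOpen_ball.measurableSet
  have hne : (MeasureTheory.ae (MeasureTheory.volume.restrict (Metric.ball (0 : ℝ) ρ))).NeBot := by
    rw [MeasureTheory.ae_neBot, Ne, MeasureTheory.Measure.restrict_eq_zero]
    exact (Metric.measure_ball_pos _ _ hρ).ne'
  obtain ⟨t, ht1, ht2⟩ := (hae.and
    (MeasureTheory.ae_restrict_mem Metric.isOpen_ball.measurableSet)).exists
  exact ⟨t, (hball ht2).1.2, ht1.differentiableAt (Metric.isOpen_ball.mem_nhds ht2)⟩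

/-- Up to a factor `r`, the coordinate difference quotient at `0` has norm `d 1 (φ t) / |t| = c`;
then `r` tends to `1`. -/
theorem IsInfinitesimallyIsometric.norm_deriv_eq
    (H : IsInfinitesimallyIsometric d f g) (hφ0 : φ 0 = 1) (hδ : 0 < δ) (hc : 0 ≤ c)
    (hφ : ∀ s t : ℝ, |s| < δ → |t| < δ → d (φ s) (φ t) = ENNReal.ofReal (c * |s - t|))
    {v : F} (hv : HasDerivAt (f ∘ φ) v 0) : ‖v‖ = c := by
  have hφt := H.tendsto_curve hφ0 hδ hφ
  have hslope : Filter.Tendsto (fun t : ℝ ↦ ‖t⁻¹ • f (φ t)‖) (𝓝[≠] 0) (𝓝 ‖v‖) := by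
    have := (hasDerivAt_iff_tendsto_slope_zero.1 hv).norm
    simpa [hφ0, H.map_one] using this
  have hδ' : ∀ᶠ t in 𝓝[≠] (0 : ℝ), |t| < δ :=
    mem_nhdsWithin_of_mem_nhds (by
      filter_upwards [Metric.ball_mem_nhds (0 : ℝ) hδ] with t ht
      simpa using ht)
  have hne : ∀ᶠ t in 𝓝[≠] (0 : ℝ), t ≠ 0 := self_mem_nhdsWithin
  have hdist : ∀ t, |t| < δ → d 1 (φ t) = ENNReal.ofReal (c * |t|) := by
    intro t ht
    rw [← hφ0, hφ 0 t (by simpa using hδ) ht, zero_sub, abs_neg]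
  have hup : ∀ r : ℝ, 1 < r → ‖v‖ ≤ r * c := by
    intro r hr
    obtain ⟨U, hU, hlow⟩ := H.enorm_sub_le r hr
    refine le_of_tendsto hslope ?_
    filter_upwards [hδ', hne, mem_nhdsWithin_of_mem_nhds (hφt hU)] with t ht ht0 htU
    have := hlow 1 (mem_of_mem_nhds hU) _ htU
    rw [H.map_one, zero_sub, enorm_neg, hdist t ht, ← ENNReal.ofReal_mul (by positivity),
      ← ofReal_norm, ENNReal.ofReal_le_ofReal_iff (by positivity)] at this
    have ht' : 0 < |t| := abs_pos.2 ht0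
    rw [norm_smul, norm_inv, Real.norm_eq_abs, inv_mul_le_iff₀ ht']
    linarith
  have hlo : ∀ r : ℝ, 1 < r → c ≤ r * ‖v‖ := by
    intro r hr
    obtain ⟨U, hU, hupp⟩ := H.le_enorm_sub r hr
    refine ge_of_tendsto (hslope.const_mul r) ?_
    filter_upwards [hδ', hne, mem_nhdsWithin_of_mem_nhds (hφt hU)] with t ht ht0 htU
    have := hupp 1 (mem_of_mem_nhds hU) _ htU
    rw [H.map_one, zero_sub, enorm_neg, hdist t ht, ← ofReal_norm,
      ← ENNReal.ofReal_mul (by positivity), ENNReal.ofReal_le_ofReal_iff (by positivity)] at this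
    have ht' : 0 < |t| := abs_pos.2 ht0
    rw [norm_smul, norm_inv, Real.norm_eq_abs, ← mul_assoc, mul_comm r, mul_assoc,
      le_inv_mul_iff₀ ht']
    linarith
  have hlim : ∀ x : ℝ, Filter.Tendsto (fun r : ℝ ↦ r * x) (𝓝[>] 1) (𝓝 x) := fun x ↦ by
    refine tendsto_nhdsWithin_of_tendsto_nhds ?_
    have : Continuous fun r : ℝ ↦ r * x := by fun_prop
    simpa using this.tendsto 1
  exact le_antisymm
    (ge_of_tendsto (hlim c) (by filter_upwards [self_mem_nhdsWithin] with r hr using hup r hr))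
    (ge_of_tendsto (hlim _) (by filter_upwards [self_mem_nhdsWithin] with r hr using hlo r hr))

end

section

open Manifold

variable {E : Type*} [NormedAddCommGroup E] [NormedSpace ℝ E]
  {G : Type*} [TopologicalSpace G] [ChartedSpace E G] [Group G] [LieGroup 𝓘(ℝ, E) ∞ G]

/-- A homomorphism from `ℝ` to a Riemannian Lie group which has constant speed near `0` is
smooth, and an integral curve of a right-invariant vector field. -/
theorem exists_isMIntegralCurve_of_hom [FiniteDimensional ℝ E]
    [RiemannianBundle (fun x : G ↦ TangentSpace 𝓘(ℝ, E) x)]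
    [IsContMDiffRiemannianBundle 𝓘(ℝ, E) ∞ E (fun x : G ↦ TangentSpace 𝓘(ℝ, E) x)]
    {φ : ℝ → G} (hφ : ∀ s t, φ (s + t) = φ s * φ t) {c δ : ℝ} (hc : 0 ≤ c) (hδ : 0 < δ)
    (hd : ∀ s t : ℝ, |s| < δ → |t| < δ →
      riemannianEDist 𝓘(ℝ, E) (φ s) (φ t) = ENNReal.ofReal (c * |s - t|)) :
    ∃ ψ : TangentSpace 𝓘(ℝ, E) (1 : G), IsOneParameterSubgroup E φ ∧ ‖ψ‖ = c ∧
      IsMIntegralCurve φ (rightInvariantField ψ) := by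
  obtain ⟨K, H, hK⟩ := exists_isInfinitesimallyIsometric (E := E) (G := G)
  have hφ0 := hom_zero hφ
  have hsrc := H.tendsto_curve hφ0 hδ hd (extChartAt_source_mem_nhds (I := 𝓘(ℝ, E)) (1 : G))
  have : FiniteDimensional ℝ (TangentSpace 𝓘(ℝ, E) (1 : G)) :=
    inferInstanceAs (FiniteDimensional ℝ E)
  -- One point of differentiability suffices, by translation. It is taken in the interior so that
  -- `φ` stays in the chart domain near it.
  obtain ⟨t₀, ht₀, hdt₀⟩ := H.exists_differentiableAt hφ0 hδ hc hd (interior_mem_nhds.2 hsrc)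
  set χ := extChartAt 𝓘(ℝ, E) (1 : G) with hχ
  have hβ : DifferentiableAt ℝ (χ ∘ φ) t₀ := by
    have h1 := (K.toContinuousLinearMap.differentiableAt.comp t₀ hdt₀).const_add (χ 1)
    refine h1.congr_of_eventuallyEq (Filter.Eventually.of_forall fun t ↦ ?_)
    simp
  have hsymm : MDifferentiableAt 𝓘(ℝ, E) 𝓘(ℝ, E) χ.symm ((χ ∘ φ) t₀) :=
    ((contMDiffOn_extChartAt_symm (n := ∞) (1 : G)).contMDiffAt
      (extChartAt_target_mem_nhds' (χ.map_source (interior_subset (s := φ ⁻¹' χ.source) ht₀)))).mdifferentiableAt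
      (by simp)
  have hmd₀ : MDifferentiableAt 𝓘(ℝ, ℝ) 𝓘(ℝ, E) φ t₀ := by
    refine (hsymm.comp t₀ hβ.mdifferentiableAt).congr_of_eventuallyEq ?_
    filter_upwards [isOpen_interior.mem_nhds ht₀] with t ht
    exact (χ.left_inv (interior_subset (s := φ ⁻¹' χ.source) ht)).symm
  have hmd := mdifferentiable_of_hom hφ hmd₀
  set L : ℝ →L[ℝ] TangentSpace 𝓘(ℝ, E) (1 : G) := mfderiv 𝓘(ℝ, ℝ) 𝓘(ℝ, E) φ 0 with hL
  have hL0 : HasMFDerivAt 𝓘(ℝ, ℝ) 𝓘(ℝ, E) φ 0 L := (hmd 0).hasMFDerivAt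
  refine ⟨L 1, ⟨contMDiff_of_hom hφ hmd, hφ⟩, ?_, isMIntegralCurve_of_hom hφ hL0⟩
  have h1 : ∀ x : G, x = 1 → HasMFDerivAt 𝓘(ℝ, E) 𝓘(ℝ, E) χ x
      (mfderiv 𝓘(ℝ, E) 𝓘(ℝ, E) χ 1) := by
    rintro x rfl
    exact (mdifferentiableAt_extChartAt (by simp)).hasMFDerivAt
  let D : E →L[ℝ] E := mfderiv 𝓘(ℝ, E) 𝓘(ℝ, E) χ 1
  let L' : ℝ →L[ℝ] E := L
  have h2 : HasFDerivAt (χ ∘ φ) (D.comp L') 0 :=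
    hasMFDerivAt_iff_hasFDerivAt.1 ((h1 (φ 0) hφ0).comp 0 hL0)
  have h3 := (K.symm.toContinuousLinearMap.hasFDerivAt.comp_hasDerivAt (0 : ℝ)
    (h2.hasDerivAt.sub_const (χ 1)))
  exact (hK (L 1)).symm.trans (H.norm_deriv_eq hφ0 hδ hc hd h3)

end

/-! ### The geodesic vector field, and the conclusion for geodesics. -/

section

open Manifold

variable {E : Type*} [NormedAddCommGroup E] [NormedSpace ℝ E]
  {G : Type*} [TopologicalSpace G] [ChartedSpace E G] [Group G]

-- Needed because `1 * g` and `g * 1` are not `g` by definition, although all tangent spaces are the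
-- same space `E`.
omit [Group G] in
theorem inner_tangentSpace_congr [RiemannianBundle (fun x : G ↦ TangentSpace 𝓘(ℝ, E) x)]
    {x y : G} (h : x = y) (v w : E) :
    @inner ℝ (TangentSpace 𝓘(ℝ, E) x) _ v w = @inner ℝ (TangentSpace 𝓘(ℝ, E) y) _ v w := by
  subst h; rfl

theorem inner_rightInvariantField [RiemannianBundle (fun x : G ↦ TangentSpace 𝓘(ℝ, E) x)]
    (hG : IsBiinvariantMetric E G) (g : G) (v w : TangentSpace 𝓘(ℝ, E) (1 : G)) :
    inner ℝ (rightInvariantField v g) (rightInvariantField w g) = inner ℝ v w :=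
  (inner_tangentSpace_congr (E := E) (one_mul g) _ _).symm.trans (hG.2 g 1 v w)

theorem inner_mulInvariantVectorField [RiemannianBundle (fun x : G ↦ TangentSpace 𝓘(ℝ, E) x)]
    (hG : IsBiinvariantMetric E G) (g : G) (v w : TangentSpace 𝓘(ℝ, E) (1 : G)) :
    inner ℝ (mulInvariantVectorField v g) (mulInvariantVectorField w g) = inner ℝ v w :=
  (inner_tangentSpace_congr (E := E) (mul_one g) _ _).symm.trans (hG.1 g 1 v w)

variable [LieGroup 𝓘(ℝ, E) ∞ G]

/-- The chain rule at the unit for `(g * h * g⁻¹) * g = g * h`. -/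
theorem rightInvariantField_adjointRep (g : G) (w : TangentSpace 𝓘(ℝ, E) (1 : G)) :
    rightInvariantField (adjointRep g w) g = mulInvariantVectorField w g := by
  have h1 : ∀ x : G, x = 1 → HasMFDerivAt 𝓘(ℝ, E) 𝓘(ℝ, E) (fun y : G ↦ y * g) x
      (mfderiv 𝓘(ℝ, E) 𝓘(ℝ, E) (fun y : G ↦ y * g) 1) := by
    rintro x rfl
    exact ((contMDiff_mul_right (I := 𝓘(ℝ, E)) (n := ∞)).mdifferentiable
      (by simp) _).hasMFDerivAt
  have h2 : HasMFDerivAt 𝓘(ℝ, E) 𝓘(ℝ, E) (fun h : G ↦ g * h * g⁻¹) 1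
      (mfderiv 𝓘(ℝ, E) 𝓘(ℝ, E) (fun h : G ↦ g * h * g⁻¹) 1) :=
    (((contMDiff_mul_right (I := 𝓘(ℝ, E)) (n := ∞) (a := g⁻¹)).comp
      (contMDiff_mul_left (I := 𝓘(ℝ, E)) (n := ∞) (a := g))).mdifferentiable
      (by simp) _).hasMFDerivAt
  have h3 := HasMFDerivAt.comp (f := fun h : G ↦ g * h * g⁻¹) (1 : G)
    (h1 (g * 1 * g⁻¹) (by simp)) h2
  have e : (fun y : G ↦ y * g) ∘ (fun h : G ↦ g * h * g⁻¹) = fun h ↦ g * h := by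
    ext h; simp
  rw [e] at h3
  exact (congrArg (fun L : E →L[ℝ] E ↦ L w) h3.mfderiv).symm

/-- The preimage comes from the differential of the shift by `g⁻¹`. It supplies both enough test
vectors for uniqueness and the vector `u g` for existence. -/
theorem mulInvariantVectorField_surjective (g : G) (z : TangentSpace 𝓘(ℝ, E) g) :
    ∃ w : TangentSpace 𝓘(ℝ, E) (1 : G), mulInvariantVectorField w g = z := by
  have h1 : ∀ x : G, x = 1 → HasMFDerivAt 𝓘(ℝ, E) 𝓘(ℝ, E) (fun y : G ↦ g * y) x
      (mfderiv 𝓘(ℝ, E) 𝓘(ℝ, E) (fun y : G ↦ g * y) 1) := by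
    rintro x rfl
    exact ((contMDiff_mul_left (I := 𝓘(ℝ, E)) (n := ∞)).mdifferentiable
      (by simp) _).hasMFDerivAt
  have h2 : HasMFDerivAt 𝓘(ℝ, E) 𝓘(ℝ, E) (fun y : G ↦ g⁻¹ * y) g
      (mfderiv 𝓘(ℝ, E) 𝓘(ℝ, E) (fun y : G ↦ g⁻¹ * y) g) :=
    ((contMDiff_mul_left (I := 𝓘(ℝ, E)) (n := ∞)).mdifferentiable (by simp) _).hasMFDerivAt
  have h3 := HasMFDerivAt.comp (f := fun y : G ↦ g⁻¹ * y) g (h1 (g⁻¹ * g) (by simp)) h2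
  have e : (fun y : G ↦ g * y) ∘ (fun y : G ↦ g⁻¹ * y) = id := by
    ext h; simp
  rw [e] at h3
  exact ⟨mfderiv 𝓘(ℝ, E) 𝓘(ℝ, E) (fun y : G ↦ g⁻¹ * y) g z,
    congrArg (fun L : E →L[ℝ] E ↦ L z) (h3.mfderiv.symm.trans (hasMFDerivAt_id g).mfderiv)⟩

/-- For a bi-invariant metric, the defining equation of the geodesic vector field at `g` says that
its value is the one of the right-invariant field. -/
theorem inner_eq_inner_adjointRep_iff [RiemannianBundle (fun x : G ↦ TangentSpace 𝓘(ℝ, E) x)]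
    (hG : IsBiinvariantMetric E G) (ψ u : TangentSpace 𝓘(ℝ, E) (1 : G)) (g : G) :
    (∀ w : TangentSpace 𝓘(ℝ, E) (1 : G), inner ℝ u w = inner ℝ ψ (adjointRep g w)) ↔
      mulInvariantVectorField u g = rightInvariantField ψ g := by
  have h1 : ∀ w : TangentSpace 𝓘(ℝ, E) (1 : G), inner ℝ ψ (adjointRep g w) =
      inner ℝ (rightInvariantField ψ g) (mulInvariantVectorField w g) := fun w ↦ by
    rw [← inner_rightInvariantField hG g, rightInvariantField_adjointRep]
  constructor
  · intro h
    refine ext_inner_right ℝ fun z ↦ ?_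
    obtain ⟨w, rfl⟩ := mulInvariantVectorField_surjective g z
    rw [inner_mulInvariantVectorField hG, h, h1]
  · intro h w
    rw [h1, ← h, inner_mulInvariantVectorField hG]

theorem isGeodesicVectorField_iff [RiemannianBundle (fun x : G ↦ TangentSpace 𝓘(ℝ, E) x)]
    (hG : IsBiinvariantMetric E G) (ψ : TangentSpace 𝓘(ℝ, E) (1 : G))
    (V : (g : G) → TangentSpace 𝓘(ℝ, E) g) :
    IsGeodesicVectorField ψ V ↔ V = rightInvariantField ψ := by
  constructor
  · rintro ⟨u, hu, hV⟩
    ext g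
    rw [hV g]
    exact (inner_eq_inner_adjointRep_iff hG ψ (u g) g).1 (hu g)
  · rintro rfl
    choose u hu using fun g : G ↦
      mulInvariantVectorField_surjective (E := E) g (rightInvariantField ψ g)
    exact ⟨u, fun g ↦ (inner_eq_inner_adjointRep_iff hG ψ (u g) g).2 (hu g), fun g ↦ (hu g).symm⟩

/-- A geodesic through the unit of a Lie group with a bi-invariant metric is a homomorphism. -/
theorem IsGeodesicOn.exists_hom [T2Space G]
    [RiemannianBundle (fun x : G ↦ TangentSpace 𝓘(ℝ, E) x)]
    [IsContMDiffRiemannianBundle 𝓘(ℝ, E) ∞ E (fun x : G ↦ TangentSpace 𝓘(ℝ, E) x)]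
    (hG : IsBiinvariantMetric E G) {J : Set ℝ} {γ : ℝ → G} {c : ℝ} (hJ : J.OrdConnected)
    (hJn : J.Nontrivial) (h0 : (0 : ℝ) ∈ J) (hγ0 : γ 0 = 1) (hγ : IsGeodesicOn E γ J c) :
    ∃ φ : ℝ → G, (∀ s t, φ (s + t) = φ s * φ t) ∧ Set.EqOn γ φ J := by
  have : IsTopologicalGroup G := topologicalGroup_of_lieGroup 𝓘(ℝ, E) ∞
  obtain ⟨K, H, -⟩ := exists_isInfinitesimallyIsometric (E := E) (G := G)
  refine exists_hom_of_locally hJ hJn h0 hγ0 fun t ht ↦ ?_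
  obtain ⟨U, hU, hdist⟩ := hγ.2 t ht
  obtain ⟨ε, hε, hball⟩ := Metric.mem_nhdsWithin_iff.1 hU
  have hI : (Metric.ball t ε ∩ J).OrdConnected := by
    rw [Real.ball_eq_Ioo]
    exact Set.ordConnected_Ioo.inter hJ
  obtain ⟨φ, hφ, hγφ⟩ := exists_hom_of_increments hI
    ((riemannianEDist_isBiinvariantEDist hG).increments_eq H hγ.1 hI
      fun s hs s' hs' ↦ hdist s ⟨hball hs, hs.2⟩ s' ⟨hball hs', hs'.2⟩)
  exact ⟨Metric.ball t ε, Metric.ball_mem_nhds t hε, φ, hφ, hγφ⟩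

/-- Since `0` may be an endpoint of `J`, constant speed is read off around an interior point `t₁` of
`J` close to `0` and moved to `0` by right invariance. -/
theorem IsGeodesicOn.exists_riemannianEDist_hom [T2Space G]
    [RiemannianBundle (fun x : G ↦ TangentSpace 𝓘(ℝ, E) x)]
    [IsContMDiffRiemannianBundle 𝓘(ℝ, E) ∞ E (fun x : G ↦ TangentSpace 𝓘(ℝ, E) x)]
    (hG : IsBiinvariantMetric E G) {J : Set ℝ} {γ : ℝ → G} {c : ℝ} (hJ : J.OrdConnected)
    (hJn : J.Nontrivial) (h0 : (0 : ℝ) ∈ J) (hγ : IsGeodesicOn E γ J c)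
    {φ : ℝ → G} (hφ : ∀ s t, φ (s + t) = φ s * φ t) (hγφ : Set.EqOn γ φ J) :
    ∃ δ > 0, ∀ s t : ℝ, |s| < δ → |t| < δ →
      riemannianEDist 𝓘(ℝ, E) (φ s) (φ t) = ENNReal.ofReal (c * |s - t|) := by
  obtain ⟨U, hU, hdist⟩ := hγ.2 0 h0
  obtain ⟨ε, hε, hball⟩ := Metric.mem_nhdsWithin_iff.1 hU
  obtain ⟨b, hb, hb0⟩ := hJn.exists_ne 0
  obtain ⟨t₁, δ, hδ, hmem⟩ : ∃ t₁ δ : ℝ, 0 < δ ∧ ∀ s, |s| < δ →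
      s + t₁ ∈ Metric.ball 0 ε ∩ J := by
    rcases hb0.lt_or_gt with h | h
    · refine ⟨-(min (-b) ε / 2), min (-b) ε / 2, by
        have : 0 < min (-b) ε := lt_min (by linarith) hε
        positivity, fun s hs ↦ ?_⟩
      have h1 := min_le_left (-b) ε
      have h2 := min_le_right (-b) ε
      rw [abs_lt] at hs
      refine ⟨?_, hJ.out hb h0 ⟨by linarith, by linarith⟩⟩
      rw [mem_ball_zero_iff, Real.norm_eq_abs, abs_lt]
      constructor <;> linarith
    · refine ⟨min b ε / 2, min b ε / 2, by
        have : 0 < min b ε := lt_min h hε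
        positivity, fun s hs ↦ ?_⟩
      have h1 := min_le_left b ε
      have h2 := min_le_right b ε
      rw [abs_lt] at hs
      refine ⟨?_, hJ.out h0 hb ⟨by linarith, by linarith⟩⟩
      rw [mem_ball_zero_iff, Real.norm_eq_abs, abs_lt]
      constructor <;> linarith
  refine ⟨δ, hδ, fun s t hs ht ↦ ?_⟩
  have m1 := hmem s hs
  have m2 := hmem t ht
  rw [← (riemannianEDist_isBiinvariantEDist hG).mul_right (φ t₁), ← hφ, ← hφ, ← hγφ m1.2,
    ← hγφ m2.2, hdist _ ⟨hball m1, m1.2⟩ _ ⟨hball m2, m2.2⟩, add_sub_add_right_eq_sub]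

end

theorem corollary1 {E : Type*} [NormedAddCommGroup E] [NormedSpace ℝ E] [FiniteDimensional ℝ E]
    {G : Type*} [TopologicalSpace G] [T2Space G] [ChartedSpace E G] [Group G]
    [LieGroup 𝓘(ℝ, E) ∞ G]
    [RiemannianBundle (fun x : G ↦ TangentSpace 𝓘(ℝ, E) x)]
    [IsContMDiffRiemannianBundle 𝓘(ℝ, E) ∞ E (fun x : G ↦ TangentSpace 𝓘(ℝ, E) x)]
    (hG : IsBiinvariantMetric E G) :
    (∀ (J : Set ℝ) (γ : ℝ → G) (c : ℝ), J.OrdConnected → J.Nontrivial → (0 : ℝ) ∈ J →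
      γ 0 = 1 → IsGeodesicOn E γ J c →
      ∃ (φ : ℝ → G) (ψ : TangentSpace 𝓘(ℝ, E) (1 : G)),
        IsOneParameterSubgroup E φ ∧ Set.EqOn γ φ J ∧ ‖ψ‖ = c ∧
        IsMIntegralCurve φ (rightInvariantField ψ)) ∧
    (∀ (ψ : TangentSpace 𝓘(ℝ, E) (1 : G)) (V : (g : G) → TangentSpace 𝓘(ℝ, E) g),
      IsGeodesicVectorField ψ V ↔ V = rightInvariantField ψ) := by
  refine ⟨fun J γ c hJ hJn h0 hγ0 hγ ↦ ?_, isGeodesicVectorField_iff hG⟩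
  obtain ⟨φ, hφ, hγφ⟩ := hγ.exists_hom hG hJ hJn h0 hγ0
  obtain ⟨δ, hδ, hd⟩ := hγ.exists_riemannianEDist_hom hG hJ hJn h0 hφ hγφ
  obtain ⟨ψ, hφs, hψ, hφψ⟩ := exists_isMIntegralCurve_of_hom hφ hγ.1 hδ hd
  exact ⟨φ, ψ, hφs, hγφ, hψ, hφψ⟩
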